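/- Let $J_0$ be a real symmetric Jacobi matrix of period 2, with diagonal entries $b_n^0\in\mathbb R$ and off-diagonal entries $a_n^0>0$, $n\ge1$ ($a_{n+2}^0=a_n^0$, $b_{n+2}^0=b_n^0$, $a_0^0:=a_2^0$). Suppose that, as an operator in $\ell^2(\mathbb N)$, it has continuous spectrum $$\sigma_c(J_0)=[-d,-s]\cup[s,d],\qquad 0<s<d .$$ Let $J$ be a complex Jacobi matrix with entries $b_n$ on the diagonal, $c_n$ above it and $a_n$ below it, so that $(Jy)_n=a_{n-1}y_{n-1}+b_ny_n+c_ny_{n+1}$ for $n\geq 1$, with the term $a_0y_0$ absent. Assume $a_nc_n\ne0$ for $n\ge1$, that $J$ is a bounded operator in $\ell^2(\mathbb N)$ and that $J-J_0$ is compact. Put $$d_m=|b_m^0-b_m|+\Big|a_{m-1}^0-\frac{a_{m-1}c_{m-1}}{a_{m-1}^0}\Big|,\qquad m\ge1,$$ where $a_0,c_0\in\mathbb C$ are arbitrary (for $a_0=c_0=a_0^0$ the second term of $d_1$ vanishes), and assume $\sum_{m\ge1} d_m<\infty$. Let $s_n(\lambda)$, $c_n(\lambda)$ be the solutions of $a_{n-1}^0y_{n-1}+b_n^0y_n+a_n^0y_{n+1}=\lambda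 y_n$, $n\ge1$, with $s_0=0,s_1=1$ and $c_0=1,c_1=0$, and let $u=\frac12(s_3+c_2)$ be the Hill discriminant. Let $w^2(\lambda)=u(\lambda)-(u^2(\lambda)-1)^{1/2}$, $|w(\lambda)|\le1$, be the Floquet multiplier (for $\lambda\in\sigma_c(J_0)$ either of the two conjugate values may be taken). Let $\nu=b_1^0$, let $\varepsilon=1$ if $J_0$ has an eigenvalue in $(-s,s)$ (which is then $\nu$) and $\varepsilon=-1$ otherwise. Let $t\simeq0.567$ be the unique positive root of $xe^x=1$ and $$K_2(s,d)=\frac{1024\sqrt2\,d^5}{(d-s)^5(d^2-s^2)^{1/2}} .$$ Then $J$ has no discrete spectrum in the domain of all $\lambda\in\mathbb C$ for which the denominator below is non-zero and $$\frac{K_2(s,d)\,|w(\lambda)|}{|w^2(\lambda)-w^{2\varepsilon}(\nu)|\,|1-w^4(\lambda)|}\sum_{m=1}^\infty d_m<t .$$ That is, this domain contains no isolated point of the spectrum of $J$ that is an eigenvalue of finite algebraic multiplicity, and no eigenvalue of $J$ outside $\sigma_c(J_0)$. -/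

import Mathlib

open scoped Topology ENNReal

/-- The complex Hilbert space `ℓ²(ℕ)`, `ℕ = {1, 2, …}`.  The coordinate number `k` of Lean's
zero-based `ℕ` is the coordinate `y_{k+1}`. -/
abbrev EllTwo : Type := lp (fun _ : ℕ => ℂ) 2

/-- The entries of a bounded complex Jacobi matrix: `b n` (`n ≥ 1`) on the diagonal, `c n`
(`n ≥ 1`) above it, `a n` (`n ≥ 1`) below it.  The numbers `a 0`, `b 0`, `c 0` are not entries of
the matrix and are left free. -/
structure JacobiMatrix where
  a : ℕ → ℂ
  b : ℕ → ℂ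
  c : ℕ → ℂ
  ne_zero : ∀ n, 1 ≤ n → a n * c n ≠ 0
  bounded : ∃ C : ℝ, ∀ n, 1 ≤ n → ‖a n‖ ≤ C ∧ ‖b n‖ ≤ C ∧ ‖c n‖ ≤ C

namespace JacobiMatrix

/-- The product of the infinite matrix with a column vector:
`(J y)_n = a_{n-1} y_{n-1} + b_n y_n + c_n y_{n+1}`, with `n = k + 1` and no `y_0` term. -/
def act (J : JacobiMatrix) (y : ℕ → ℂ) : ℕ → ℂ
  | 0 => J.b 1 * y 0 + J.c 1 * y 1
  | k + 1 => J.a (k + 1) * y k + J.b (k + 2) * y (k + 1) + J.c (k + 2) * y (k + 2)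

theorem memlp_of_le {C : ℝ} {f y : ℕ → ℂ} (hy : Memℓp y 2) (h : ∀ k, ‖f k‖ ≤ C * ‖y k‖) :
    Memℓp f 2 := by
  have h2 : (0 : ℝ) < (2 : ℝ≥0∞).toReal := by norm_num
  have hs := (memℓp_gen_iff h2).1 hy
  refine (memℓp_gen_iff h2).2 ?_
  simp only [ENNReal.toReal_ofNat, Real.rpow_ofNat] at hs ⊢
  refine Summable.of_nonneg_of_le (fun k => by positivity) (fun k => ?_) (hs.mul_left (C ^ 2))
  rw [← mul_pow]
  exact pow_le_pow_left₀ (norm_nonneg _) (h k) 2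

theorem memlp_succ {y : ℕ → ℂ} (hy : Memℓp y 2) : Memℓp (fun k => y (k + 1)) 2 := by
  have h2 : (0 : ℝ) < (2 : ℝ≥0∞).toReal := by norm_num
  have hs := (memℓp_gen_iff h2).1 hy
  exact (memℓp_gen_iff h2).2 ((summable_nat_add_iff 1).2 hs)

theorem memlp_of_succ {y : ℕ → ℂ} (hy : Memℓp (fun k => y (k + 1)) 2) : Memℓp y 2 := by
  have h2 : (0 : ℝ) < (2 : ℝ≥0∞).toReal := by norm_num
  have hs := (memℓp_gen_iff h2).1 hy
  exact (memℓp_gen_iff h2).2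
    ((summable_nat_add_iff (f := fun k => ‖y k‖ ^ (2 : ℝ≥0∞).toReal) 1).1 hs)

theorem act_memlp (J : JacobiMatrix) (y : EllTwo) : Memℓp (J.act y) 2 := by
  obtain ⟨C, hC⟩ := J.bounded
  have hy : Memℓp (fun k => y k) 2 := y.2
  refine memlp_of_succ ?_
  have e0 : Memℓp (fun k => J.a (k + 1) * y k) 2 := memlp_of_le (C := C) hy fun k => by
    rw [norm_mul]
    exact mul_le_mul_of_nonneg_right (hC _ (by omega)).1 (norm_nonneg _)
  have e1 : Memℓp (fun k => J.b (k + 2) * y (k + 1)) 2 :=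
    memlp_of_le (C := C) (memlp_succ hy) fun k => by
      rw [norm_mul]
      exact mul_le_mul_of_nonneg_right (hC _ (by omega)).2.1 (norm_nonneg _)
  have e2 : Memℓp (fun k => J.c (k + 2) * y (k + 2)) 2 :=
    memlp_of_le (C := C) (memlp_succ (memlp_succ hy)) fun k => by
      rw [norm_mul]
      exact mul_le_mul_of_nonneg_right (hC _ (by omega)).2.2 (norm_nonneg _)
  exact (e0.add e1).add e2

/-- The linear operator of a Jacobi matrix in `ℓ²`. -/
def toLin (J : JacobiMatrix) : EllTwo →ₗ[ℂ] EllTwo where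
  toFun y := ⟨J.act y, J.act_memlp y⟩
  map_add' x y := by
    ext k
    change J.act (⇑x + ⇑y) k = J.act x k + J.act y k
    cases k <;> simp only [act, Pi.add_apply] <;> ring
  map_smul' r y := by
    ext k
    change J.act (r • ⇑y) k = r * J.act y k
    cases k <;> simp only [act, Pi.smul_apply, smul_eq_mul] <;> ring

theorem continuous_coord (k : ℕ) : Continuous fun y : EllTwo => y k :=
  (continuous_apply k).comp (lp.uniformContinuous_coe (E := fun _ : ℕ => ℂ) (p := 2)).continuous

theorem continuous_act (J : JacobiMatrix) (k : ℕ) : Continuous fun y : EllTwo => J.act y k := by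
  have h := continuous_coord
  cases k with
  | zero =>
    exact (continuous_const.mul (h 0)).add (continuous_const.mul (h 1))
  | succ k =>
    exact ((continuous_const.mul (h k)).add (continuous_const.mul (h (k + 1)))).add
      (continuous_const.mul (h (k + 2)))

/-- The bounded operator of a Jacobi matrix in `ℓ²`; continuity is by the closed graph theorem. -/
noncomputable def op (J : JacobiMatrix) : EllTwo →L[ℂ] EllTwo :=
  ContinuousLinearMap.ofSeqClosedGraph (g := J.toLin) fun u x y hu hv => by
    ext k
    have h1 := ((continuous_coord k).tendsto y).comp hv
    have h2 := ((J.continuous_act k).tendsto x).comp hu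
    exact tendsto_nhds_unique h1 h2

theorem op_apply (J : JacobiMatrix) (y : EllTwo) (k : ℕ) : J.op y k = J.act y k := rfl

end JacobiMatrix

/-- The entries of a real symmetric Jacobi matrix of period `2`: `b n` on the diagonal and `a n` on
both neighbouring diagonals, `n ≥ 1`.  Periodicity from `n = 0` on fixes `a 0 = a 2`. -/
structure TwoPeriodicJacobi where
  a : ℕ → ℝ
  b : ℕ → ℝ
  a_pos : ∀ n, 0 < a n
  a_periodic : ∀ n, a (n + 2) = a n
  b_periodic : ∀ n, b (n + 2) = b n

namespace TwoPeriodicJacobi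

theorem abs_le_of_periodic {f : ℕ → ℝ} (h : ∀ n, f (n + 2) = f n) :
    ∀ n, |f n| ≤ |f 0| + |f 1|
  | 0 => le_add_of_nonneg_right (abs_nonneg _)
  | 1 => le_add_of_nonneg_left (abs_nonneg _)
  | n + 2 => by rw [h]; exact abs_le_of_periodic h n

/-- The periodic matrix as a complex Jacobi matrix. -/
def toJacobi (J₀ : TwoPeriodicJacobi) : JacobiMatrix where
  a n := (J₀.a n : ℂ)
  b n := (J₀.b n : ℂ)
  c n := (J₀.a n : ℂ)
  ne_zero n _ := by
    have := (J₀.a_pos n).ne'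
    exact mul_ne_zero (by exact_mod_cast this) (by exact_mod_cast this)
  bounded := by
    refine ⟨(|J₀.a 0| + |J₀.a 1|) + (|J₀.b 0| + |J₀.b 1|), fun n _ => ?_⟩
    have ha := abs_le_of_periodic J₀.a_periodic n
    have hb := abs_le_of_periodic J₀.b_periodic n
    have h0 := abs_nonneg (J₀.a n)
    have h1 := abs_nonneg (J₀.b n)
    simp only [Complex.norm_real, Real.norm_eq_abs]
    exact ⟨by linarith, by linarith, by linarith⟩

/-- The solution of `a_{n-1} y_{n-1} + b_n y_n + a_n y_{n+1} = z y_n` (`n ≥ 1`) with given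
initial data `y_0`, `y_1`. -/
noncomputable def solution (J₀ : TwoPeriodicJacobi) (z y₀ y₁ : ℂ) : ℕ → ℂ
  | 0 => y₀
  | 1 => y₁
  | n + 2 => ((z - J₀.b (n + 1)) * solution J₀ z y₀ y₁ (n + 1)
      - J₀.a n * solution J₀ z y₀ y₁ n) / J₀.a (n + 1)

/-- The Hill discriminant `u = (s_3 + c_2) / 2`, where `s` and `c` are the solutions with
`s_0 = 0`, `s_1 = 1` and `c_0 = 1`, `c_1 = 0`. -/
noncomputable def hill (J₀ : TwoPeriodicJacobi) (z : ℂ) : ℂ :=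
  (J₀.solution z 0 1 3 + J₀.solution z 1 0 2) / 2

/-- The Floquet multiplier `u - (u² - 1)^{1/2}`, with the square root for which its modulus is at
most `1`.  For `z` in a band both square roots qualify, and the two multipliers are conjugate. -/
noncomputable def multiplier (J₀ : TwoPeriodicJacobi) (z : ℂ) : ℂ :=
  if ‖J₀.hill z - (J₀.hill z ^ 2 - 1) ^ (1 / 2 : ℂ)‖ ≤
      ‖J₀.hill z + (J₀.hill z ^ 2 - 1) ^ (1 / 2 : ℂ)‖
  then J₀.hill z - (J₀.hill z ^ 2 - 1) ^ (1 / 2 : ℂ)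
  else J₀.hill z + (J₀.hill z ^ 2 - 1) ^ (1 / 2 : ℂ)

/-- A number `w(z)` with `w(z)²` the Floquet multiplier and `|w(z)| ≤ 1`.  Only the modulus of `w`
and its even powers are used below, so the choice of its sign is immaterial. -/
noncomputable def w (J₀ : TwoPeriodicJacobi) (z : ℂ) : ℂ :=
  J₀.multiplier z ^ (1 / 2 : ℂ)

/-- The point `ν = b_1` of the closed gap `[-s, s]`, the zero of the polynomial `s_2`. -/
def nu (J₀ : TwoPeriodicJacobi) : ℝ := J₀.b 1

open scoped Classical in
/-- `ε = 1` if the periodic operator has an eigenvalue in the gap `(-s, s)` and `ε = -1`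
otherwise. -/
noncomputable def eps (J₀ : TwoPeriodicJacobi) (s : ℝ) : ℤ :=
  if ∃ μ : ℝ, -s < μ ∧ μ < s ∧
      Module.End.HasEigenvalue (J₀.toJacobi.op : EllTwo →ₗ[ℂ] EllTwo) (μ : ℂ)
  then 1 else -1

end TwoPeriodicJacobi

/-- The continuous spectrum of a bounded operator: `T - z` is injective with dense range, but not
surjective. -/
def contSpectrum (T : EllTwo →L[ℂ] EllTwo) : Set ℂ :=
  {z | Function.Injective (T - z • ContinuousLinearMap.id ℂ EllTwo) ∧
    DenseRange (T - z • ContinuousLinearMap.id ℂ EllTwo) ∧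
    ¬ Function.Surjective (T - z • ContinuousLinearMap.id ℂ EllTwo)}

/-- The discrete spectrum of a bounded operator: the isolated points of the spectrum that are
eigenvalues of finite algebraic multiplicity. -/
def discSpectrum (T : EllTwo →L[ℂ] EllTwo) : Set ℂ :=
  {z | (∃ r : ℝ, 0 < r ∧ spectrum ℂ T ∩ Metric.ball z r = {z}) ∧
    Module.End.HasEigenvalue (T : EllTwo →ₗ[ℂ] EllTwo) z ∧
    FiniteDimensional ℂ (Module.End.maxGenEigenspace (T : EllTwo →ₗ[ℂ] EllTwo) z)}

/-- `perturbation J₀ J k` is `d_m = |b_m⁰ - b_m| + |a_{m-1}⁰ - a_{m-1} c_{m-1} / a_{m-1}⁰|` with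
`m = k + 1`. -/
noncomputable def perturbation (J₀ : TwoPeriodicJacobi) (J : JacobiMatrix) (k : ℕ) : ℝ :=
  ‖(J₀.b (k + 1) : ℂ) - J.b (k + 1)‖ + ‖(J₀.a k : ℂ) - J.a k * J.c k / (J₀.a k : ℂ)‖

/-- `K_2(s, d) = 1024 √2 d⁵ / ((d - s)⁵ (d² - s²)^{1/2})`. -/
noncomputable def kTwo (s d : ℝ) : ℝ :=
  1024 * √2 * d ^ 5 / ((d - s) ^ 5 * √(d ^ 2 - s ^ 2))

/-- The domain of all `z` with
`K_2(s, d) |w(z)| / (|w²(z) - w^{2ε}(ν)| |1 - w⁴(z)|) * ∑ d_m < t`, where the denominator is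
required not to vanish. -/
noncomputable def freeRegion (J₀ : TwoPeriodicJacobi) (J : JacobiMatrix) (s d t : ℝ) : Set ℂ :=
  {z | ‖J₀.w z ^ 2 - J₀.w J₀.nu ^ (2 * J₀.eps s)‖ * ‖1 - J₀.w z ^ 4‖ ≠ 0 ∧
    kTwo s d * ‖J₀.w z‖ /
      (‖J₀.w z ^ 2 - J₀.w J₀.nu ^ (2 * J₀.eps s)‖ * ‖1 - J₀.w z ^ 4‖) *
        ∑' k, perturbation J₀ J k < t}

/-! Off the bands the multiplier θ = w² satisfies |θ| < 1, and the periodic recurrence has two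
explicit solutions when a₁⁰ + a₂⁰θ ≠ 0: `sineSol`, vanishing at 0, and `jostSol`, decaying like
|w|ⁿ. Multiply an eigenvector of J by the gauge factors ∏ cᵢ/aᵢ⁰. This turns the superdiagonal into
a⁰ and the subdiagonal into aₙcₙ/aₙ⁰, so the new sequence x solves the periodic recurrence up to a
source term controlled by exactly the numbers d_m. Variation of constants with the Green kernel sᵢfⱼ
(i ≤ j), bounded in `norm_green_le`, then makes x a fixed point of a linear map of norm less than 1,
hence zero (`eq_zero_of_green_bound`, `not_hasEigenvalue_of_green`). The gauge may make x grow, but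
compactness gives cₙ − aₙ⁰ → 0, so x is O(Qⁿ) for every Q > 1. Choosing Q|w| < 1, the contraction
works in the sup norm weighted by Qⁿ.

The Green kernel carries the denominator |a₁⁰ + a₂⁰θ| |1 − θ²|. The identity `multiplier_factor`
forces θ(ν) to be −a₁⁰/a₂⁰ or its inverse, and ε selects the exponent for which w(ν)^{2ε} = −a₁⁰/a₂⁰
(`w_nu_zpow`). Thus the denominator is the one in the statement up to the factor a₂⁰.

The bands enter through the equivalence of z ∈ σ_c(J₀) with |θ(z)| = 1. One direction is a
Wiener–Hopf factorization of a quadratic polynomial in J₀, the other uses oscillation and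
self-adjointness. It yields b₁⁰ + b₂⁰ = 0 and d², s² = ν² + (a₁⁰ ± a₂⁰)² (`parameters_of_bands`). At
points of the bands only isolation has to be excluded: by the Fredholm alternative the bands stay in
the spectrum of J, and they have no isolated points. -/

/-! ### Variation of constants and contraction for a three-term recurrence. -/

/-- A solution `x` of a perturbed three-term recurrence with `x 0 = 0` and restricted growth
vanishes if the Green kernel of the unperturbed recurrence times the perturbation is small. -/
theorem eq_zero_of_green_bound {a b s f x h : ℕ → ℂ} {e : ℕ → ℝ} {z : ℂ} {A C r Q : ℝ}
    (ha : ∀ n, ‖a n‖ ≤ A) (ha0 : a 0 ≠ 0) (hr : 0 ≤ r) (hQ : 1 ≤ Q) (hr1 : r ≤ 1) (hrQ : r * Q < 1)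
    (hs : ∀ n, a n * s n + b (n + 1) * s (n + 1) + a (n + 1) * s (n + 2) = z * s (n + 1))
    (hf : ∀ n, a n * f n + b (n + 1) * f (n + 1) + a (n + 1) * f (n + 2) = z * f (n + 1))
    (hx : ∀ n, a n * x n + b (n + 1) * x (n + 1) + a (n + 1) * x (n + 2) = z * x (n + 1) - h n)
    (hs0 : s 0 = 0) (hs1 : s 1 = 1) (hf0 : f 0 = 1) (hx0 : x 0 = 0)
    (hsf : ∀ i j, i ≤ j → ‖s i * f j‖ ≤ C * r ^ (j - i))
    (he : ∀ n, ‖h n‖ ≤ e n * max ‖x (n + 1)‖ ‖x n‖) (he0 : ∀ n, 0 ≤ e n) (hes : Summable e)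
    (hCe : C * ∑' n, e n < ‖a 0‖) (hxQ : ∃ X, ∀ n, ‖x n‖ ≤ X * Q ^ n) : x = 0 := by
  have hC : 0 ≤ C := by
    have := (norm_nonneg _).trans (hsf 0 0 le_rfl)
    simpa using this
  -- Green's formula: the sum telescopes to a Wronskian, and its boundary term at 0 vanishes because
  -- s₀ = x₀ = 0.
  have h1 : ∀ n, ∑ m ∈ Finset.range n, s (m + 1) * h m =
      -(a n * (s n * x (n + 1) - s (n + 1) * x n)) := by
    intro n
    induction n with
    | zero => simp [hs0, hx0]
    | succ n ih =>
      rw [Finset.sum_range_succ, ih]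
      linear_combination s (n + 1) * hx n - x (n + 1) * hs n
  have h2 : ∀ n N, ∑ m ∈ Finset.range N, f (n + m + 1) * h (n + m) =
      a n * (f n * x (n + 1) - f (n + 1) * x n) -
      a (n + N) * (f (n + N) * x (n + N + 1) - f (n + N + 1) * x (n + N)) := by
    intro n N
    induction N with
    | zero => simp
    | succ N ih =>
      rw [Finset.sum_range_succ, ih]
      rw [← add_assoc n N 1]
      linear_combination f (n + N + 1) * hx (n + N) - x (n + N + 1) * hf (n + N)
  have h3 : ∀ n, a n * (s (n + 1) * f n - s n * f (n + 1)) = a 0 := by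
    intro n
    induction n with
    | zero => simp [hs0, hs1, hf0]
    | succ n ih =>
      linear_combination ih + f (n + 1) * hs n - s (n + 1) * hf n
  -- Variation of constants, truncated at n + N because decay of the boundary term at infinity is
  -- not yet known. The terms in xₙ₊₁ cancel, and the constant Wronskian `h3` produces the factor
  -- a₀.
  have hrep : ∀ n N, a 0 * x n = ∑ m ∈ Finset.range n, s (m + 1) * f n * h m +
      ∑ m ∈ Finset.range N, s n * f (n + m + 1) * h (n + m) +
      a (n + N) * (s n * f (n + N) * x (n + N + 1) - s n * f (n + N + 1) * x (n + N)) := by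
    intro n N
    have e1 : ∑ m ∈ Finset.range n, s (m + 1) * f n * h m =
        f n * ∑ m ∈ Finset.range n, s (m + 1) * h m := by
      rw [Finset.mul_sum]; exact Finset.sum_congr rfl fun m _ => by ring
    have e2 : ∑ m ∈ Finset.range N, s n * f (n + m + 1) * h (n + m) =
        s n * ∑ m ∈ Finset.range N, f (n + m + 1) * h (n + m) := by
      rw [Finset.mul_sum]; exact Finset.sum_congr rfl fun m _ => by ring
    rw [e1, e2, h1, h2]
    linear_combination -x n * h3 n
  have hA : 0 ≤ A := (norm_nonneg _).trans (ha 0)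
  -- One application of the Green operator in the norm sup |xₙ|/Qⁿ. To the left of n the weight Qᵐ⁺¹
  -- is at most Qⁿ; to the right its growth is absorbed by the decay of the kernel, since rQ < 1.
  have step : ∀ X, (∀ n, ‖x n‖ ≤ X * Q ^ n) →
      ∀ n, ‖a 0‖ * ‖x n‖ ≤ C * (∑' n, e n) * X * Q ^ n := by
    intro X hX n
    have hX0 : 0 ≤ X := by simpa using (norm_nonneg _).trans (hX 0)
    have hh : ∀ m, ‖h m‖ ≤ e m * (X * Q ^ (m + 1)) := fun m =>
      (he m).trans <| mul_le_mul_of_nonneg_left (max_le (hX _) ((hX m).trans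
        (mul_le_mul_of_nonneg_left (pow_le_pow_right₀ hQ (Nat.le_succ m)) hX0))) (he0 m)
    have hQ0 : 0 ≤ Q := by linarith
    have b1 : ∀ m ∈ Finset.range n, ‖s (m + 1) * f n * h m‖ ≤ C * X * Q ^ n * e m := by
      intro m hm
      have hmn : m + 1 ≤ n := Finset.mem_range.1 hm
      calc ‖s (m + 1) * f n * h m‖ = ‖s (m + 1) * f n‖ * ‖h m‖ := norm_mul _ _
        _ ≤ (C * r ^ (n - (m + 1))) * (e m * (X * Q ^ (m + 1))) :=
          mul_le_mul (hsf _ _ hmn) (hh m) (norm_nonneg _) (by positivity)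
        _ ≤ (C * 1) * (e m * (X * Q ^ n)) := by
          have := he0 m
          gcongr
          exact pow_le_one₀ hr hr1
        _ = _ := by ring
    have b2 : ∀ N, ∀ m ∈ Finset.range N, ‖s n * f (n + m + 1) * h (n + m)‖ ≤
        C * X * Q ^ n * e (n + m) := by
      intro N m _
      calc ‖s n * f (n + m + 1) * h (n + m)‖ = ‖s n * f (n + m + 1)‖ * ‖h (n + m)‖ := norm_mul _ _
        _ ≤ (C * r ^ (m + 1)) * (e (n + m) * (X * Q ^ (n + m + 1))) := by
          refine mul_le_mul ?_ (hh _) (norm_nonneg _) (by positivity)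
          have := hsf n (n + m + 1) (by omega)
          rwa [show n + m + 1 - n = m + 1 by omega] at this
        _ = C * X * Q ^ n * e (n + m) * (r * Q) ^ (m + 1) := by ring
        _ ≤ C * X * Q ^ n * e (n + m) * 1 := by
          have := he0 (n + m)
          gcongr
          exact pow_le_one₀ (by positivity) hrQ.le
        _ = _ := mul_one _
    have b3 : ∀ N, ‖a (n + N) * (s n * f (n + N) * x (n + N + 1) - s n * f (n + N + 1) * x (n + N))‖ ≤
        A * (C * X * Q ^ (n + 1) * 2) * (r * Q) ^ N := by
      intro N
      rw [norm_mul, mul_assoc A]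
      refine mul_le_mul (ha _) ?_ (norm_nonneg _) hA
      have t1 : ‖s n * f (n + N) * x (n + N + 1)‖ ≤ (C * r ^ N) * (X * Q ^ (n + N + 1)) := by
        rw [norm_mul]
        refine mul_le_mul ?_ (hX _) (norm_nonneg _) (by positivity)
        have := hsf n (n + N) (by omega)
        rwa [show n + N - n = N by omega] at this
      have t2 : ‖s n * f (n + N + 1) * x (n + N)‖ ≤ (C * r ^ N) * (X * Q ^ (n + N + 1)) := by
        rw [norm_mul]
        refine mul_le_mul ?_ ((hX _).trans ?_) (norm_nonneg _) (by positivity)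
        · have := hsf n (n + N + 1) (by omega)
          rw [show n + N + 1 - n = N + 1 by omega] at this
          refine this.trans (mul_le_mul_of_nonneg_left ?_ hC)
          exact pow_le_pow_of_le_one hr hr1 (Nat.le_succ N)
        · exact mul_le_mul_of_nonneg_left (pow_le_pow_right₀ hQ (Nat.le_succ _)) hX0
      calc _ ≤ _ := norm_sub_le _ _
        _ ≤ (C * r ^ N) * (X * Q ^ (n + N + 1)) + (C * r ^ N) * (X * Q ^ (n + N + 1)) :=
          add_le_add t1 t2
        _ = _ := by ring
    have tot : ∀ N, ‖a 0‖ * ‖x n‖ ≤ C * (∑' n, e n) * X * Q ^ n +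
        A * (C * X * Q ^ (n + 1) * 2) * (r * Q) ^ N := by
      intro N
      rw [← norm_mul, hrep n N]
      refine (norm_add_le _ _).trans (add_le_add ?_ (b3 N))
      calc _ ≤ _ := norm_add_le _ _
        _ ≤ ∑ m ∈ Finset.range n, C * X * Q ^ n * e m +
            ∑ m ∈ Finset.range N, C * X * Q ^ n * e (n + m) :=
          add_le_add (norm_sum_le_of_le _ b1) (norm_sum_le_of_le _ (b2 N))
        _ = C * X * Q ^ n * ∑ m ∈ Finset.range (n + N), e m := by
          rw [Finset.sum_range_add, mul_add, Finset.mul_sum, Finset.mul_sum]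
        _ ≤ C * X * Q ^ n * ∑' n, e n := by
          gcongr
          exact hes.sum_le_tsum _ fun i _ => he0 i
        _ = _ := by ring
    have lim : Filter.Tendsto (fun N : ℕ => C * (∑' n, e n) * X * Q ^ n +
        A * (C * X * Q ^ (n + 1) * 2) * (r * Q) ^ N) Filter.atTop
        (𝓝 (C * (∑' n, e n) * X * Q ^ n + A * (C * X * Q ^ (n + 1) * 2) * 0)) :=
      ((tendsto_pow_atTop_nhds_zero_of_lt_one (by positivity) hrQ).const_mul _).const_add _
    rw [mul_zero, add_zero] at lim
    exact ge_of_tendsto' lim tot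
  have hap : 0 < ‖a 0‖ := norm_pos_iff.2 ha0
  obtain ⟨X, hX⟩ := hxQ
  -- Each application of `step` improves the weighted bound by the factor κ < 1.
  set κ := C * (∑' n, e n) / ‖a 0‖ with hκ
  have hκ0 : 0 ≤ κ := div_nonneg (mul_nonneg hC (tsum_nonneg he0)) hap.le
  have hκ1 : κ < 1 := (div_lt_one hap).2 hCe
  have iter : ∀ k n, ‖x n‖ ≤ κ ^ k * X * Q ^ n := by
    intro k
    induction k with
    | zero => simpa using hX
    | succ k ih =>
      intro n
      have := step _ ih n
      rw [mul_comm, ← le_div_iff₀ hap] at this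
      refine this.trans (le_of_eq ?_)
      rw [pow_succ]
      nth_rewrite 3 [hκ]
      ring
  funext n
  have lim : Filter.Tendsto (fun k : ℕ => κ ^ k * (X * Q ^ n)) Filter.atTop (𝓝 (0 * (X * Q ^ n))) :=
    (tendsto_pow_atTop_nhds_zero_of_lt_one hκ0 hκ1).mul_const _
  rw [zero_mul] at lim
  have := ge_of_tendsto' lim fun k => by simpa [mul_assoc] using iter k n
  exact norm_le_zero_iff.1 this

/-! ### The Hill discriminant and the Floquet multiplier. -/

theorem Complex.sqrt_cpow_sq (x : ℂ) : (x ^ (1 / 2 : ℂ)) ^ 2 = x := by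
  have := Complex.cpow_nat_inv_pow x (n := 2) (by norm_num)
  rwa [show ((2 : ℕ) : ℂ)⁻¹ = 1 / 2 by norm_num] at this

namespace TwoPeriodicJacobi

variable (J₀ : TwoPeriodicJacobi)

theorem hill_eq (z : ℂ) : 2 * (J₀.a 0 * J₀.a 1) * J₀.hill z =
    (z - J₀.b 0) * (z - J₀.b 1) - J₀.a 0 ^ 2 - J₀.a 1 ^ 2 := by
  have h0 : (J₀.a 0 : ℂ) ≠ 0 := by exact_mod_cast (J₀.a_pos 0).ne'
  have h1 : (J₀.a 1 : ℂ) ≠ 0 := by exact_mod_cast (J₀.a_pos 1).ne'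
  have e : J₀.a 2 = J₀.a 0 := J₀.a_periodic 0
  have e' : J₀.b 2 = J₀.b 0 := J₀.b_periodic 0
  simp only [hill, solution, e, e', zero_add, Nat.reduceAdd]
  field_simp
  ring

theorem multiplier_quadratic (z : ℂ) :
    J₀.multiplier z ^ 2 - 2 * J₀.hill z * J₀.multiplier z + 1 = 0 := by
  have h := Complex.sqrt_cpow_sq (J₀.hill z ^ 2 - 1)
  unfold multiplier
  split_ifs <;> linear_combination h

theorem multiplier_ne_zero (z : ℂ) : J₀.multiplier z ≠ 0 := by
  intro h
  have := J₀.multiplier_quadratic z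
  simp [h] at this

theorem norm_multiplier_le_one (z : ℂ) : ‖J₀.multiplier z‖ ≤ 1 := by
  have h := Complex.sqrt_cpow_sq (J₀.hill z ^ 2 - 1)
  have hp : ‖J₀.hill z - (J₀.hill z ^ 2 - 1) ^ (1 / 2 : ℂ)‖ *
      ‖J₀.hill z + (J₀.hill z ^ 2 - 1) ^ (1 / 2 : ℂ)‖ = 1 := by
    rw [← norm_mul, show (J₀.hill z - (J₀.hill z ^ 2 - 1) ^ (1 / 2 : ℂ)) *
      (J₀.hill z + (J₀.hill z ^ 2 - 1) ^ (1 / 2 : ℂ)) = 1 by linear_combination -h, norm_one]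
  have h1 := norm_nonneg (J₀.hill z - (J₀.hill z ^ 2 - 1) ^ (1 / 2 : ℂ))
  have h2 := norm_nonneg (J₀.hill z + (J₀.hill z ^ 2 - 1) ^ (1 / 2 : ℂ))
  unfold multiplier
  split_ifs with hc <;> nlinarith

/-- The characteristic equation of the monodromy matrix, factorized. -/
theorem multiplier_factor (z : ℂ) :
    (z - J₀.b 0) * (z - J₀.b 1) * J₀.multiplier z =
      (J₀.a 0 + J₀.a 1 * J₀.multiplier z) * (J₀.a 1 + J₀.a 0 * J₀.multiplier z) := by
  linear_combination -J₀.multiplier z * J₀.hill_eq z -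
    (J₀.a 0 * J₀.a 1) * J₀.multiplier_quadratic z

theorem w_sq (z : ℂ) : J₀.w z ^ 2 = J₀.multiplier z := Complex.sqrt_cpow_sq _

theorem norm_w_sq (z : ℂ) : ‖J₀.w z‖ ^ 2 = ‖J₀.multiplier z‖ := by
  rw [← norm_pow, w_sq]

/-- The multiplier at a real point has modulus one exactly if the point lies in a band. -/
theorem norm_multiplier_eq_one_iff (x : ℝ) : ‖J₀.multiplier x‖ = 1 ↔
    (J₀.a 1 - J₀.a 0) ^ 2 ≤ (x - J₀.b 0) * (x - J₀.b 1) ∧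
      (x - J₀.b 0) * (x - J₀.b 1) ≤ (J₀.a 1 + J₀.a 0) ^ 2 := by
  have hα := J₀.a_pos 0
  have hβ := J₀.a_pos 1
  have hαβ := mul_pos hα hβ
  set u : ℝ := ((x - J₀.b 0) * (x - J₀.b 1) - J₀.a 0 ^ 2 - J₀.a 1 ^ 2) / (2 * (J₀.a 0 * J₀.a 1))
    with hu
  have hu' : u * (2 * (J₀.a 0 * J₀.a 1)) =
      (x - J₀.b 0) * (x - J₀.b 1) - J₀.a 0 ^ 2 - J₀.a 1 ^ 2 := by
    rw [hu]; field_simp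
  have huc : J₀.hill x = (u : ℂ) := by
    have h := J₀.hill_eq x
    have hne : (2 * (J₀.a 0 * J₀.a 1) : ℂ) ≠ 0 := by
      exact_mod_cast (by positivity : (2 * (J₀.a 0 * J₀.a 1)) ≠ 0)
    have h2 : (u : ℂ) * (2 * (J₀.a 0 * J₀.a 1)) =
      (x - J₀.b 0) * (x - J₀.b 1) - J₀.a 0 ^ 2 - J₀.a 1 ^ 2 := by exact_mod_cast hu'
    apply mul_left_cancel₀ hne
    rw [h, ← h2]; ring
  have hq := J₀.multiplier_quadratic x
  rw [huc] at hq
  set θ := J₀.multiplier x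
  have key : ‖θ‖ = 1 ↔ |u| ≤ 1 := by
    constructor
    · intro h
      have hc : θ * (starRingEnd ℂ) θ = 1 := by
        rw [Complex.mul_conj, Complex.normSq_eq_norm_sq, h]; norm_num
      have h2 : (2 * u : ℂ) = θ + (starRingEnd ℂ) θ := by
        linear_combination (θ - 2 * u) * hc - (starRingEnd ℂ) θ * hq
      rw [Complex.add_conj] at h2
      have h3 : 2 * u = 2 * θ.re := by exact_mod_cast h2
      have h4 := Complex.abs_re_le_norm θ
      rw [h] at h4
      rwa [show u = θ.re by linarith]
    · intro h
      have hre := congrArg Complex.re hq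
      have him := congrArg Complex.im hq
      simp [pow_two] at hre him
      have hn : ‖θ‖ ^ 2 = 1 := by
        rw [← Complex.normSq_eq_norm_sq, Complex.normSq_apply]
        -- The imaginary part of θ² − 2uθ + 1 = 0: either θ is real, and then |u| ≤ 1 forces θ = u =
        -- ±1, or Re θ = u and the real part gives |θ|² = 1.
        have h0 : θ.im * (θ.re - u) = 0 := by linarith
        rcases mul_eq_zero.1 h0 with h0 | h0
        · rw [h0] at hre ⊢
          obtain ⟨h1, h2⟩ := abs_le.1 h
          nlinarith [mul_nonneg (sub_nonneg.2 h2) (by linarith : 0 ≤ 1 + u),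
            sq_nonneg (θ.re - u)]
        · have : θ.re = u := by linarith
          rw [this] at hre ⊢
          nlinarith
      nlinarith [norm_nonneg θ]
  rw [key, abs_le]
  constructor
  · rintro ⟨h1, h2⟩
    constructor <;> nlinarith
  · rintro ⟨h1, h2⟩
    constructor <;> nlinarith

/-- Points outside the real line have multiplier of modulus less than one. -/
theorem im_eq_zero_of_norm_multiplier (z : ℂ) (h : ‖J₀.multiplier z‖ = 1) : z.im = 0 := by
  have hα := J₀.a_pos 0
  have hβ := J₀.a_pos 1
  have hq := J₀.multiplier_quadratic z
  have hh := J₀.hill_eq z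
  set θ := J₀.multiplier z
  have hc : θ * (starRingEnd ℂ) θ = 1 := by
    rw [Complex.mul_conj, Complex.normSq_eq_norm_sq, h]; norm_num
  have h2 : 2 * J₀.hill z = θ + (starRingEnd ℂ) θ := by
    linear_combination (θ - 2 * J₀.hill z) * hc - (starRingEnd ℂ) θ * hq
  rw [Complex.add_conj] at h2
  have h5 : (z - J₀.b 0) * (z - J₀.b 1) =
      ((J₀.a 0 * J₀.a 1 * (2 * θ.re) + J₀.a 0 ^ 2 + J₀.a 1 ^ 2 : ℝ) : ℂ) := by
    push_cast
    push_cast at h2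
    linear_combination (J₀.a 0 * J₀.a 1) * h2 - hh
  have hre := congrArg Complex.re h5
  have him := congrArg Complex.im h5
  rw [Complex.ofReal_re] at hre
  rw [Complex.ofReal_im] at him
  simp at hre him
  have h4 := abs_le.1 ((Complex.abs_re_le_norm θ).trans h.le)
  by_contra hz
  -- The product in `h5` is at least (a 0 − a 1)² ≥ 0. For non-real z its being real puts Re z at
  -- the midpoint of b 0 and b 1, where the product is negative.
  have h6 : 2 * z.re = J₀.b 0 + J₀.b 1 := by
    have : z.im * (2 * z.re - (J₀.b 0 + J₀.b 1)) = 0 := by linarith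
    rcases mul_eq_zero.1 this with h | h
    · exact absurd h hz
    · linarith
  have h7 : 0 < z.im ^ 2 := by positivity
  have h8 : z.re = (J₀.b 0 + J₀.b 1) / 2 := by linarith
  rw [h8] at hre
  nlinarith [sq_nonneg (J₀.b 0 - J₀.b 1), sq_nonneg (J₀.a 0 - J₀.a 1), mul_pos hα hβ]

theorem periodic_pair {f : ℕ → ℝ} (h : ∀ n, f (n + 2) = f n) :
    ∀ k, f (2 * k) = f 0 ∧ f (2 * k + 1) = f 1
  | 0 => ⟨rfl, rfl⟩
  | k + 1 => by
    have := periodic_pair h k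
    exact ⟨(h (2 * k)).trans this.1, (h (2 * k + 1)).trans this.2⟩

end TwoPeriodicJacobi

/-! ### Explicit solutions of the periodic recurrence and the bound of the Green kernel. -/

namespace TwoPeriodicJacobi

/-- The Chebyshev polynomials `U_{k-1}` of the second kind, evaluated at `(θ + θ⁻¹) / 2`. -/
noncomputable def cheb (θ : ℂ) (k : ℕ) : ℂ := (θ ^ k - θ⁻¹ ^ k) / (θ - θ⁻¹)

theorem sub_inv_ne_zero {θ : ℂ} (h0 : θ ≠ 0) (h1 : ‖θ‖ < 1) : θ - θ⁻¹ ≠ 0 := by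
  intro h
  have h2 : θ * θ = 1 := by
    have := mul_inv_cancel₀ h0
    linear_combination θ * h + this
  have h3 := congrArg norm h2
  rw [norm_mul, norm_one] at h3
  nlinarith [norm_nonneg θ]

theorem cheb_zero (θ : ℂ) : cheb θ 0 = 0 := by simp [cheb]

theorem cheb_one {θ : ℂ} (h0 : θ ≠ 0) (h1 : ‖θ‖ < 1) : cheb θ 1 = 1 := by
  simp [cheb, div_self (sub_inv_ne_zero h0 h1)]

theorem cheb_rec {θ : ℂ} (h0 : θ ≠ 0) (k : ℕ) :
    θ * cheb θ (k + 2) = (θ ^ 2 + 1) * cheb θ (k + 1) - θ * cheb θ k := by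
  unfold cheb
  rw [mul_div_assoc', mul_div_assoc', mul_div_assoc', ← sub_div]
  congr 1
  have := mul_inv_cancel₀ h0
  linear_combination (-θ⁻¹ ^ (k + 1) + θ * θ⁻¹ ^ k) * this

/-- The growth θ⁻ᵏ of the Chebyshev factor is cancelled by the decay of the Jost solution: the
product is (1 − θ²ᵏ)θⁱ⁺¹/(1 − θ²). -/
theorem norm_cheb_mul_pow_le {θ : ℂ} (h0 : θ ≠ 0) (h1 : ‖θ‖ < 1) (k i : ℕ) :
    ‖cheb θ k * θ ^ (k + i)‖ ≤ 2 * ‖θ‖ ^ (i + 1) / ‖1 - θ ^ 2‖ := by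
  have e : cheb θ k * θ ^ (k + i) = (1 - θ ^ (2 * k)) * θ ^ (i + 1) / (1 - θ ^ 2) := by
    have h2 := sub_inv_ne_zero h0 h1
    have h3 : 1 - θ ^ 2 ≠ 0 := by
      intro h
      apply h2
      field_simp
      linear_combination -h
    have h4 := mul_inv_cancel₀ h0
    have h5 : θ⁻¹ ^ k * θ ^ k = 1 := by rw [← mul_pow, inv_mul_cancel₀ h0, one_pow]
    rw [cheb, div_mul_eq_mul_div, div_eq_div_iff h2 h3]
    have e1 : θ ^ (k + i) = θ ^ k * θ ^ i := pow_add _ _ _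
    have e2 : θ ^ (2 * k) = θ ^ k * θ ^ k := by rw [two_mul, pow_add]
    rw [e1, e2, pow_succ]
    linear_combination (-θ ^ i * (1 - θ ^ 2)) * h5 + (1 - θ ^ k * θ ^ k) * θ ^ i * h4
  rw [e, norm_div, norm_mul, norm_pow]
  gcongr
  calc _ ≤ ‖(1 : ℂ)‖ + ‖θ ^ (2 * k)‖ := norm_sub_le _ _
    _ ≤ 1 + 1 := by
      rw [norm_one, norm_pow]
      gcongr
      exact pow_le_one₀ (norm_nonneg _) h1.le
    _ = 2 := by norm_num

variable (J₀ : TwoPeriodicJacobi)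

/-- The solution with values `0`, `1` at `0`, `1`, in terms of the multiplier. -/
noncomputable def sineSol (z : ℂ) (n : ℕ) : ℂ :=
  if Even n then (z - J₀.b 1) / J₀.a 1 * cheb (J₀.multiplier z) (n / 2)
  else cheb (J₀.multiplier z) (n / 2 + 1) +
    J₀.a 0 / J₀.a 1 * cheb (J₀.multiplier z) (n / 2)

/-- The decaying solution with value `1` at `0`. -/
noncomputable def jostSol (z : ℂ) (n : ℕ) : ℂ :=
  if Even n then J₀.multiplier z ^ (n / 2)
  else (z - J₀.b 0) * J₀.multiplier z ^ (n / 2 + 1) / (J₀.a 1 + J₀.a 0 * J₀.multiplier z)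

theorem sineSol_even (z : ℂ) (k : ℕ) :
    J₀.sineSol z (2 * k) = (z - J₀.b 1) / J₀.a 1 * cheb (J₀.multiplier z) k := by
  simp [sineSol]

theorem sineSol_odd (z : ℂ) (k : ℕ) : J₀.sineSol z (2 * k + 1) =
    cheb (J₀.multiplier z) (k + 1) + J₀.a 0 / J₀.a 1 * cheb (J₀.multiplier z) k := by
  simp [sineSol, show (2 * k + 1) / 2 = k by omega]

theorem jostSol_even (z : ℂ) (k : ℕ) : J₀.jostSol z (2 * k) = J₀.multiplier z ^ k := by
  simp [jostSol]

theorem jostSol_odd (z : ℂ) (k : ℕ) : J₀.jostSol z (2 * k + 1) =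
    (z - J₀.b 0) * J₀.multiplier z ^ (k + 1) / (J₀.a 1 + J₀.a 0 * J₀.multiplier z) := by
  simp [jostSol, show (2 * k + 1) / 2 = k by omega]

theorem ofReal_a_ne_zero (n : ℕ) : (J₀.a n : ℂ) ≠ 0 := by exact_mod_cast (J₀.a_pos n).ne'

/-- A two-periodic recurrence may be checked separately at the odd and at the even indices. -/
theorem recurrence_of_parity {z : ℂ} {y : ℕ → ℂ}
    (h1 : ∀ k, J₀.a 0 * y (2 * k) + J₀.b 1 * y (2 * k + 1) + J₀.a 1 * y (2 * (k + 1)) =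
      z * y (2 * k + 1))
    (h2 : ∀ k, J₀.a 1 * y (2 * k + 1) + J₀.b 0 * y (2 * (k + 1)) + J₀.a 0 * y (2 * (k + 1) + 1) =
      z * y (2 * (k + 1))) (n : ℕ) :
    J₀.a n * y n + J₀.b (n + 1) * y (n + 1) + J₀.a (n + 1) * y (n + 2) = z * y (n + 1) := by
  rcases Nat.even_or_odd' n with ⟨k, rfl | rfl⟩
  · have ea := periodic_pair J₀.a_periodic k
    have eb := periodic_pair J₀.b_periodic k
    rw [ea.1, ea.2, eb.2]
    exact h1 k
  · have ea := periodic_pair J₀.a_periodic k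
    have ea' := periodic_pair J₀.a_periodic (k + 1)
    have eb' := periodic_pair J₀.b_periodic (k + 1)
    rw [show 2 * k + 1 + 1 = 2 * (k + 1) by ring, ea.2, ea'.1, eb'.1]
    exact h2 k

theorem sineSol_rec (z : ℂ) (n : ℕ) :
    J₀.a n * J₀.sineSol z n + J₀.b (n + 1) * J₀.sineSol z (n + 1) +
      J₀.a (n + 1) * J₀.sineSol z (n + 2) = z * J₀.sineSol z (n + 1) := by
  have h0 := J₀.multiplier_ne_zero z
  have hα := J₀.ofReal_a_ne_zero 0
  have hβ := J₀.ofReal_a_ne_zero 1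
  refine J₀.recurrence_of_parity (fun k => ?_) (fun k => ?_) n
  · simp only [sineSol_even, sineSol_odd]
    field_simp
    ring
  · simp only [sineSol_even, sineSol_odd]
    have h := cheb_rec h0 k
    have hf := J₀.multiplier_factor z
    field_simp
    apply mul_left_cancel₀ h0
    linear_combination J₀.a 1 * J₀.a 0 * h - cheb (J₀.multiplier z) (k + 1) * hf

theorem jostSol_rec {z : ℂ} (hne : (J₀.a 1 + J₀.a 0 * J₀.multiplier z : ℂ) ≠ 0) (n : ℕ) :
    J₀.a n * J₀.jostSol z n + J₀.b (n + 1) * J₀.jostSol z (n + 1) +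
      J₀.a (n + 1) * J₀.jostSol z (n + 2) = z * J₀.jostSol z (n + 1) := by
  have hf := J₀.multiplier_factor z
  refine J₀.recurrence_of_parity (fun k => ?_) (fun k => ?_) n
  · simp only [jostSol_even, jostSol_odd]
    field_simp
    linear_combination -J₀.multiplier z ^ k * hf
  · simp only [jostSol_even, jostSol_odd]
    field_simp
    ring

/-- The bound of the Green kernel, for a matrix with spectrum symmetric about the origin. -/
theorem norm_green_le {z : ℂ} {d : ℝ} (hd0 : 0 ≤ d) (hb : J₀.b 0 + J₀.b 1 = 0)
    (hd : d ^ 2 = J₀.b 1 ^ 2 + (J₀.a 1 + J₀.a 0) ^ 2) (hθ : ‖J₀.multiplier z‖ < 1)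
    (hne : (J₀.a 1 + J₀.a 0 * J₀.multiplier z : ℂ) ≠ 0) (i j : ℕ) (hij : i ≤ j) :
    ‖J₀.sineSol z i * J₀.jostSol z j‖ ≤ 4 * d ^ 2 * ‖J₀.w z‖ /
      (J₀.a 1 * ‖(J₀.a 1 + J₀.a 0 * J₀.multiplier z : ℂ)‖ * ‖1 - J₀.multiplier z ^ 2‖) *
      ‖J₀.w z‖ ^ (j - i) := by
  have h0 := J₀.multiplier_ne_zero z
  have hα := J₀.a_pos 0
  have hβ := J₀.a_pos 1
  have hf := J₀.multiplier_factor z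
  have hr2 := J₀.norm_w_sq z
  have hcheb := fun k i => norm_cheb_mul_pow_le h0 hθ k i
  have hD : 0 < ‖(J₀.a 1 + J₀.a 0 * J₀.multiplier z : ℂ)‖ := norm_pos_iff.2 hne
  have hE : 0 < ‖1 - J₀.multiplier z ^ 2‖ := by
    rw [norm_pos_iff]
    intro h
    apply sub_inv_ne_zero h0 hθ
    field_simp
    linear_combination -h
  have hz := J₀.multiplier_factor z
  have hb' : (J₀.b 0 : ℂ) = -J₀.b 1 := by exact_mod_cast (by linarith : J₀.b 0 = -J₀.b 1)
  set θ := J₀.multiplier z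
  have hr0 : 0 ≤ ‖J₀.w z‖ := norm_nonneg _
  set r := ‖J₀.w z‖
  have hr1 : r ≤ 1 := by nlinarith
  have hdα : J₀.a 1 + J₀.a 0 ≤ d := by
    refine (pow_le_pow_iff_left₀ (by positivity) hd0 two_ne_zero).1 ?_
    nlinarith [sq_nonneg (J₀.b 1)]
  have hdν : |J₀.b 1| ≤ d := by
    apply abs_le_of_sq_le_sq _ hd0
    nlinarith [sq_nonneg (J₀.a 1 + J₀.a 0)]
  have nre : ∀ x y : ℝ, 0 < x → 0 < y → ‖(x + y * θ : ℂ)‖ ≤ x + y := by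
    intro x y hx hy
    refine (norm_add_le _ _).trans ?_
    rw [norm_mul, Complex.norm_of_nonneg hx.le, Complex.norm_of_nonneg hy.le]
    nlinarith
  have hDle : ‖(J₀.a 1 + J₀.a 0 * θ : ℂ)‖ ≤ d := (nre _ _ hβ hα).trans hdα
  have hD'le : ‖(J₀.a 0 + J₀.a 1 * θ : ℂ)‖ ≤ d := by
    refine (nre _ _ hα hβ).trans ?_
    linarith
  have hprod : ‖z - J₀.b 0‖ * ‖z - J₀.b 1‖ * r ^ 2 ≤ d ^ 2 := by
    rw [hr2, ← norm_mul, ← norm_mul, hz, norm_mul, pow_two]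
    gcongr
  -- A bound uniform in z: growth of z is compensated by smallness of w. After b 0 = −b 1, the
  -- factorized characteristic equation expresses z²θ by bounded quantities whose moduli sum to at
  -- most d².
  have hzr : ‖z‖ * r ≤ d := by
    refine (pow_le_pow_iff_left₀ (by positivity) hd0 two_ne_zero).1 ?_
    have e : z ^ 2 * θ = (J₀.a 0 + J₀.a 1 * θ) * (J₀.a 1 + J₀.a 0 * θ) + (J₀.b 1 : ℂ) ^ 2 * θ := by
      rw [hb'] at hz
      linear_combination hz
    rw [mul_pow, hr2, ← norm_pow, ← norm_mul, e]
    refine (norm_add_le _ _).trans ?_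
    rw [hd, add_comm]
    gcongr
    · rw [norm_mul, norm_pow, Complex.norm_real, Real.norm_eq_abs, sq_abs]
      nlinarith [sq_nonneg (J₀.b 1)]
    · rw [norm_mul, pow_two]
      gcongr
      · exact (nre _ _ hα hβ).trans_eq (add_comm _ _)
      · exact nre _ _ hβ hα
  have hz1 : ‖z - J₀.b 1‖ * r ≤ 2 * d := by
    have : ‖z - J₀.b 1‖ ≤ ‖z‖ + |J₀.b 1| := by
      refine (norm_sub_le _ _).trans ?_
      rw [Complex.norm_real, Real.norm_eq_abs]
    nlinarith [abs_nonneg (J₀.b 1)]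
  have hz0 : ‖z - J₀.b 0‖ * r ≤ 2 * d := by
    have : ‖z - J₀.b 0‖ ≤ ‖z‖ + |J₀.b 1| := by
      rw [hb']
      refine (norm_sub_le _ _).trans ?_
      rw [norm_neg, Complex.norm_real, Real.norm_eq_abs]
    nlinarith [abs_nonneg (J₀.b 1)]
  have nα : ‖(J₀.a 0 : ℂ)‖ = J₀.a 0 := Complex.norm_of_nonneg hα.le
  have nβ : ‖(J₀.a 1 : ℂ)‖ = J₀.a 1 := Complex.norm_of_nonneg hβ.le
  set α := J₀.a 0
  set β := J₀.a 1
  set D := ‖(β + α * θ : ℂ)‖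
  set E := ‖1 - θ ^ 2‖
  rw [← hr2] at hcheb
  have hodd : ∀ k i, ‖(cheb θ (k + 1) + α / β * cheb θ k) * θ ^ (k + 1 + i)‖ ≤
      (β + α) / β * (2 * (r ^ 2) ^ (i + 1) / E) := by
    intro k i
    have e : (cheb θ (k + 1) + α / β * cheb θ k) * θ ^ (k + 1 + i) =
      cheb θ (k + 1) * θ ^ (k + 1 + i) + α / β * (cheb θ k * θ ^ (k + (i + 1))) := by
      rw [show k + (i + 1) = k + 1 + i by ring]; ring
    rw [e]
    refine (norm_add_le _ _).trans ?_
    rw [norm_mul (α / β : ℂ), norm_div, nα, nβ]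
    have h1 := hcheb (k + 1) i
    have h2 := hcheb k (i + 1)
    have h3 : 2 * (r ^ 2) ^ (i + 1 + 1) / E ≤ 2 * (r ^ 2) ^ (i + 1) / E := by
      gcongr 2 * ?_ / E
      exact pow_le_pow_of_le_one (by positivity) (by nlinarith) (Nat.le_succ _)
    calc _ ≤ 2 * (r ^ 2) ^ (i + 1) / E + α / β * (2 * (r ^ 2) ^ (i + 1) / E) := by
          gcongr
          exact h2.trans h3
      _ = _ := by field_simp
  -- In each parity case the kernel is at most 2r·rʲ⁻ⁱ/(βDE) times a product bounded by 2d²; powers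
  -- of r taken from |θ| = r² pay for the factors z − b 0 and z − b 1.
  rcases Nat.even_or_odd' i with ⟨k, rfl | rfl⟩ <;> rcases Nat.even_or_odd' j with ⟨l, rfl | rfl⟩
  · obtain ⟨p, rfl⟩ : ∃ p, l = k + p := ⟨l - k, by omega⟩
    rw [sineSol_even, jostSol_even, mul_assoc, norm_mul, norm_div, nβ,
      show 2 * (k + p) - 2 * k = 2 * p by omega]
    calc _ ≤ ‖z - J₀.b 1‖ / β * (2 * (r ^ 2) ^ (p + 1) / E) := by gcongr; exact hcheb k p
      _ = (‖z - J₀.b 1‖ * r * D) * (2 * r * r ^ (2 * p) / (β * D * E)) := by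
        field_simp
        ring
      _ ≤ (2 * d * d) * (2 * r * r ^ (2 * p) / (β * D * E)) := by gcongr
      _ = _ := by ring
  · obtain ⟨p, rfl⟩ : ∃ p, l = k + p := ⟨l - k, by omega⟩
    rw [sineSol_even, jostSol_odd, show 2 * (k + p) + 1 - 2 * k = 2 * p + 1 by omega]
    have e : (z - J₀.b 1) / β * cheb θ k * ((z - J₀.b 0) * θ ^ (k + p + 1) / (β + α * θ)) =
      ((z - J₀.b 1) / β * ((z - J₀.b 0) / (β + α * θ))) * (cheb θ k * θ ^ (k + (p + 1))) := by
      rw [show k + (p + 1) = k + p + 1 by ring]; ring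
    rw [e, norm_mul, norm_mul, norm_div, norm_div, nβ]
    calc _ ≤ ‖z - J₀.b 1‖ / β * (‖z - J₀.b 0‖ / D) * (2 * (r ^ 2) ^ (p + 1 + 1) / E) := by
          gcongr; exact hcheb k (p + 1)
      _ = (‖z - J₀.b 0‖ * ‖z - J₀.b 1‖ * r ^ 2) * (2 * r * r ^ (2 * p + 1) / (β * D * E)) := by
        field_simp
        ring
      _ ≤ (2 * d ^ 2) * (2 * r * r ^ (2 * p + 1) / (β * D * E)) := by
        refine mul_le_mul_of_nonneg_right ?_ (by positivity)
        nlinarith [sq_nonneg d]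
      _ = _ := by ring
  · obtain ⟨p, rfl⟩ : ∃ p, l = k + 1 + p := ⟨l - (k + 1), by omega⟩
    rw [sineSol_odd, jostSol_even, show 2 * (k + 1 + p) - (2 * k + 1) = 2 * p + 1 by omega]
    calc _ ≤ (β + α) / β * (2 * (r ^ 2) ^ (p + 1) / E) := hodd k p
      _ = ((β + α) * D) * (2 * r * r ^ (2 * p + 1) / (β * D * E)) := by
        field_simp
        ring
      _ ≤ (2 * (d * d)) * (2 * r * r ^ (2 * p + 1) / (β * D * E)) := by
        refine mul_le_mul_of_nonneg_right ?_ (by positivity)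
        nlinarith [mul_le_mul hdα hDle hD.le hd0, mul_nonneg hd0 hd0]
      _ = _ := by ring
  · obtain ⟨p, rfl⟩ : ∃ p, l = k + p := ⟨l - k, by omega⟩
    rw [sineSol_odd, jostSol_odd, show 2 * (k + p) + 1 - (2 * k + 1) = 2 * p by omega]
    have e : (cheb θ (k + 1) + α / β * cheb θ k) * ((z - J₀.b 0) * θ ^ (k + p + 1) / (β + α * θ)) =
      ((z - J₀.b 0) / (β + α * θ)) * ((cheb θ (k + 1) + α / β * cheb θ k) * θ ^ (k + 1 + p)) := by
      rw [show k + 1 + p = k + p + 1 by ring]; ring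
    rw [e, norm_mul, norm_div]
    calc _ ≤ ‖z - J₀.b 0‖ / D * ((β + α) / β * (2 * (r ^ 2) ^ (p + 1) / E)) := by
          gcongr; exact hodd k p
      _ = (‖z - J₀.b 0‖ * r * (β + α)) * (2 * r * r ^ (2 * p) / (β * D * E)) := by
        field_simp
        ring
      _ ≤ (2 * d * d) * (2 * r * r ^ (2 * p) / (β * D * E)) := by gcongr
      _ = _ := by ring

end TwoPeriodicJacobi

/-! ### Gauge transformation and absence of eigenvalues off the bands. -/

/-- Controls the growth of the gauge factors: the finitely many partial products before the bound
sets in are absorbed into P. -/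
theorem exists_forall_norm_prod_le {u : ℕ → ℂ} {Q : ℝ} (hQ : 1 ≤ Q)
    (hu : ∀ᶠ n in Filter.atTop, ‖u n‖ ≤ Q) :
    ∃ P, 0 ≤ P ∧ ∀ k, ‖∏ i ∈ Finset.range k, u i‖ ≤ P * Q ^ k := by
  obtain ⟨N, hN⟩ := Filter.eventually_atTop.1 hu
  refine ⟨∑ k ∈ Finset.range (N + 1), ‖∏ i ∈ Finset.range k, u i‖,
    Finset.sum_nonneg fun _ _ => norm_nonneg _, fun k => ?_⟩
  set P := ∑ k ∈ Finset.range (N + 1), ‖∏ i ∈ Finset.range k, u i‖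
  have hP : ∀ k ≤ N, ‖∏ i ∈ Finset.range k, u i‖ ≤ P := fun k hk =>
    Finset.single_le_sum (f := fun k => ‖∏ i ∈ Finset.range k, u i‖)
      (fun _ _ => norm_nonneg _) (Finset.mem_range.2 (by omega))
  have hP0 : 0 ≤ P := Finset.sum_nonneg fun _ _ => norm_nonneg _
  induction k with
  | zero => simpa using hP 0 (Nat.zero_le N)
  | succ k ih =>
    by_cases hk : k + 1 ≤ N
    · exact (hP _ hk).trans (le_mul_of_one_le_right hP0 (one_le_pow₀ hQ))
    · rw [Finset.prod_range_succ, norm_mul, pow_succ, ← mul_assoc]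
      exact mul_le_mul ih (hN k (by omega)) (norm_nonneg _) (by positivity)

theorem JacobiMatrix.act_eq_of_hasEigenvector {J : JacobiMatrix} {z : ℂ} {y : EllTwo}
    (h : Module.End.HasEigenvector (J.op : EllTwo →ₗ[ℂ] EllTwo) z y) (k : ℕ) :
    J.act y k = z * y k := by
  have h2 : J.op y = z • y := h.apply_eq_smul
  rw [← J.op_apply, h2]
  rfl

namespace TwoPeriodicJacobi

variable (J₀ : TwoPeriodicJacobi)

theorem min_a_le (n : ℕ) : min (J₀.a 0) (J₀.a 1) ≤ J₀.a n := by
  rcases Nat.even_or_odd' n with ⟨k, rfl | rfl⟩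
  · rw [(periodic_pair J₀.a_periodic k).1]; exact min_le_left _ _
  · rw [(periodic_pair J₀.a_periodic k).2]; exact min_le_right _ _

theorem norm_a_le (n : ℕ) : ‖(J₀.a n : ℂ)‖ ≤ |J₀.a 0| + |J₀.a 1| := by
  rw [Complex.norm_real, Real.norm_eq_abs]
  exact abs_le_of_periodic J₀.a_periodic n

/-- A perturbed periodic matrix has no eigenvalue `z` off the bands if the bound of the Green
kernel at `z` times the size of the perturbation is small. -/
theorem not_hasEigenvalue_of_green (J : JacobiMatrix) {z : ℂ} {d : ℝ}
    (hca : Filter.Tendsto (fun n => J.c (n + 1) - J₀.a (n + 1)) Filter.atTop (𝓝 0))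
    (hsum : Summable (perturbation J₀ J))
    (hd0 : 0 ≤ d) (hb : J₀.b 0 + J₀.b 1 = 0)
    (hd : d ^ 2 = J₀.b 1 ^ 2 + (J₀.a 1 + J₀.a 0) ^ 2) (hθ : ‖J₀.multiplier z‖ < 1)
    (hne : (J₀.a 1 + J₀.a 0 * J₀.multiplier z : ℂ) ≠ 0)
    (hC : 4 * d ^ 2 * ‖J₀.w z‖ / (J₀.a 1 * ‖(J₀.a 1 + J₀.a 0 * J₀.multiplier z : ℂ)‖ *
      ‖1 - J₀.multiplier z ^ 2‖) * ∑' k, perturbation J₀ J k < J₀.a 0) :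
    ¬ Module.End.HasEigenvalue (J.op : EllTwo →ₗ[ℂ] EllTwo) z := by
  intro hev
  obtain ⟨y, hy⟩ := hev.exists_hasEigenvector
  have hact := JacobiMatrix.act_eq_of_hasEigenvector hy
  have hr2 := J₀.norm_w_sq z
  have hr0 : 0 ≤ ‖J₀.w z‖ := norm_nonneg _
  have hr1 : ‖J₀.w z‖ < 1 := by nlinarith
  set r := ‖J₀.w z‖ with hr
  set p : ℕ → ℂ := fun k => ∏ i ∈ Finset.range k, J.c (i + 1) / J₀.a (i + 1) with hp
  have hp1 : ∀ k, J₀.a (k + 1) * p (k + 1) = J.c (k + 1) * p k := by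
    intro k
    have := J₀.ofReal_a_ne_zero (k + 1)
    rw [hp]
    simp only [Finset.prod_range_succ]
    field_simp
  have hp0 : p 0 = 1 := by simp [hp]
  have hpne : ∀ k, p k ≠ 0 := fun k => Finset.prod_ne_zero_iff.2 fun i _ =>
    div_ne_zero (right_ne_zero_of_mul (J.ne_zero (i + 1) (by omega))) (J₀.ofReal_a_ne_zero _)
  -- Any number strictly between 1 and 1/r would serve.
  set Q : ℝ := 2 / (1 + r) with hQ
  have hQ1 : 1 < Q := by rw [hQ, lt_div_iff₀ (by linarith)]; linarith
  have hrQ : r * Q < 1 := by rw [hQ, ← mul_div_assoc, div_lt_one (by linarith)]; linarith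
  have hm : 0 < min (J₀.a 0) (J₀.a 1) := lt_min (J₀.a_pos 0) (J₀.a_pos 1)
  obtain ⟨P, hP0, hP⟩ := exists_forall_norm_prod_le (u := fun i => J.c (i + 1) / J₀.a (i + 1))
      hQ1.le <| by
    have hpos : 0 < (Q - 1) * min (J₀.a 0) (J₀.a 1) := mul_pos (by linarith) hm
    filter_upwards [hca.norm.eventually (gt_mem_nhds (by simpa using hpos))] with n hn
    have ha := J₀.a_pos (n + 1)
    rw [norm_div, Complex.norm_of_nonneg ha.le, div_le_iff₀ ha]
    calc ‖J.c (n + 1)‖ = ‖(J.c (n + 1) - J₀.a (n + 1)) + J₀.a (n + 1)‖ := by rw [sub_add_cancel]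
      _ ≤ ‖J.c (n + 1) - J₀.a (n + 1)‖ + J₀.a (n + 1) := by
        refine (norm_add_le _ _).trans_eq ?_
        rw [Complex.norm_of_nonneg ha.le]
      _ ≤ Q * J₀.a (n + 1) := by nlinarith [J₀.min_a_le (n + 1)]
  -- Back to one-based numbering: `y k` is the coordinate k + 1, and x₀ = 0 encodes the missing term
  -- of the first row.
  set x : ℕ → ℂ := fun n => Nat.casesOn n 0 fun k => p k * y k with hx
  have hx0 : x 0 = 0 := rfl
  have hxs : ∀ k, x (k + 1) = p k * y k := fun k => rfl
  have hzero := eq_zero_of_green_bound (a := fun n => J₀.a n) (b := fun n => J₀.b n)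
    (s := J₀.sineSol z) (f := J₀.jostSol z) (x := x)
    (h := fun n => (J.b (n + 1) - J₀.b (n + 1)) * x (n + 1) +
      (J.a n * J.c n / J₀.a n - J₀.a n) * x n) (e := perturbation J₀ J) (z := z) (r := r) (Q := Q)
    J₀.norm_a_le (J₀.ofReal_a_ne_zero 0) hr0 hQ1.le hr1.le hrQ (J₀.sineSol_rec z)
    (J₀.jostSol_rec hne) ?_ (by simpa [cheb_zero] using J₀.sineSol_even z 0)
    (by simpa [cheb_zero, cheb_one (J₀.multiplier_ne_zero z) hθ] using J₀.sineSol_odd z 0)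
    (by simpa using J₀.jostSol_even z 0) hx0 (J₀.norm_green_le hd0 hb hd hθ hne) ?_
    (fun n => add_nonneg (norm_nonneg _) (norm_nonneg _)) hsum
    (by rwa [Complex.norm_of_nonneg (J₀.a_pos 0).le]) ⟨P * ‖y‖, ?_⟩
  · apply hy.2
    ext k
    have := congrFun hzero (k + 1)
    rw [hxs] at this
    exact (mul_eq_zero.1 this).resolve_left (hpne k)
  · rintro (_ | k)
    -- In the first row the free entries `J.a 0` and `J.c 0` are multiplied by x₀ = 0.
    · have h0 := hact 0
      simp only [JacobiMatrix.act] at h0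
      have h1 := hp1 0
      simp only [hx0, hxs, hp0, zero_add] at h1 ⊢
      linear_combination h0 + y 1 * h1
    · have h0 := hact (k + 1)
      simp only [JacobiMatrix.act] at h0
      have h1 := hp1 k
      have h2 := hp1 (k + 1)
      have ha := J₀.ofReal_a_ne_zero (k + 1)
      have h3 : J.a (k + 1) * J.c (k + 1) / J₀.a (k + 1) * p k = J.a (k + 1) * p (k + 1) := by
        rw [div_mul_eq_mul_div, div_eq_iff ha]
        linear_combination -J.a (k + 1) * h1
      simp only [hxs]
      linear_combination p (k + 1) * h0 + y (k + 2) * h2 + y k * h3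
  · intro n
    refine (norm_add_le _ _).trans ?_
    rw [perturbation, add_mul]
    refine add_le_add ?_ ?_
    · rw [norm_mul (J.b (n + 1) - J₀.b (n + 1)), norm_sub_rev]
      exact mul_le_mul_of_nonneg_left (le_max_left _ _) (norm_nonneg _)
    · rw [norm_mul (J.a n * J.c n / J₀.a n - J₀.a n), norm_sub_rev]
      exact mul_le_mul_of_nonneg_left (le_max_right _ _) (norm_nonneg _)
  · rintro (_ | k)
    · rw [hx0, norm_zero]; positivity
    · rw [hxs, norm_mul]
      calc ‖p k‖ * ‖y k‖ ≤ (P * Q ^ k) * ‖y‖ :=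
            mul_le_mul (hP k) (lp.norm_apply_le_norm (by norm_num) y k) (norm_nonneg _)
              (by positivity)
        _ ≤ (P * Q ^ (k + 1)) * ‖y‖ := by
          gcongr
          · exact hQ1.le
          · exact Nat.le_succ k
        _ = _ := by ring

end TwoPeriodicJacobi

/-! ### The continuous spectrum of the periodic operator is the set where the multiplier is
unimodular. -/

namespace EllTwo

theorem norm_sq_eq_tsum (y : EllTwo) : ‖y‖ ^ 2 = ∑' k, ‖y k‖ ^ 2 := by
  simpa using lp.norm_rpow_eq_tsum (p := 2) (by norm_num) y

theorem summable_norm_sq (y : EllTwo) : Summable fun k => ‖y k‖ ^ 2 := by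
  simpa using (memℓp_gen_iff (p := 2) (by norm_num)).1 y.2

theorem tendsto_coord_zero (y : EllTwo) : Filter.Tendsto (fun k => y k) Filter.atTop (𝓝 0) := by
  have h := (summable_norm_sq y).tendsto_atTop_zero
  rw [tendsto_zero_iff_norm_tendsto_zero]
  have := h.sqrt
  simpa using this

/-- The backward shift on `ℓ²`. -/
noncomputable def shiftLeft : EllTwo →L[ℂ] EllTwo :=
  LinearMap.mkContinuous
    { toFun := fun y => ⟨fun k => y (k + 1), JacobiMatrix.memlp_succ y.2⟩
      map_add' := fun _ _ => rfl
      map_smul' := fun _ _ => rfl } 1 fun y => by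
    rw [one_mul]
    refine (pow_le_pow_iff_left₀ (norm_nonneg _) (norm_nonneg _) two_ne_zero).1 ?_
    rw [norm_sq_eq_tsum, norm_sq_eq_tsum y, (summable_norm_sq y).tsum_eq_zero_add]
    exact le_add_of_nonneg_left (by positivity)

/-- A sequence preceded by a zero. -/
def prependZero (y : ℕ → ℂ) : ℕ → ℂ
  | 0 => 0
  | k + 1 => y k

theorem memlp_prependZero (y : EllTwo) : Memℓp (prependZero y) 2 :=
  JacobiMatrix.memlp_of_succ y.2

/-- The forward shift on `ℓ²`. -/
noncomputable def shiftRight : EllTwo →L[ℂ] EllTwo :=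
  LinearMap.mkContinuous
    { toFun := fun y => ⟨prependZero y, memlp_prependZero y⟩
      map_add' := fun x y => by
        ext n
        change prependZero (⇑x + ⇑y) n = prependZero x n + prependZero y n
        cases n <;> simp [prependZero]
      map_smul' := fun c y => by
        ext n
        change prependZero (c • ⇑y) n = c * prependZero y n
        cases n <;> simp [prependZero] } 1 fun y => by
    rw [one_mul]
    refine (pow_le_pow_iff_left₀ (norm_nonneg _) (norm_nonneg _) two_ne_zero).1 ?_
    rw [norm_sq_eq_tsum, norm_sq_eq_tsum y, (summable_norm_sq _).tsum_eq_zero_add]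
    refine le_of_eq ?_
    change ‖(0 : ℂ)‖ ^ 2 + ∑' k, ‖y k‖ ^ 2 = _
    simp

theorem shiftRight_zero (y : EllTwo) : shiftRight y 0 = 0 := rfl
theorem shiftRight_succ (y : EllTwo) (k : ℕ) : shiftRight y (k + 1) = y k := rfl

theorem norm_shiftLeft_le : ‖shiftLeft‖ ≤ 1 :=
  LinearMap.mkContinuous_norm_le _ zero_le_one _

theorem norm_shiftRight_le : ‖shiftRight‖ ≤ 1 :=
  LinearMap.mkContinuous_norm_le _ zero_le_one _

theorem isUnit_one_sub_smul_sq {S : EllTwo →L[ℂ] EllTwo} (hS : ‖S‖ ≤ 1) {θ : ℂ} (hθ : ‖θ‖ < 1) :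
    IsUnit (1 - θ • (S * S)) := by
  apply isUnit_one_sub_of_norm_lt_one
  rw [norm_smul]
  have : ‖S * S‖ ≤ 1 := (norm_mul_le _ _).trans (mul_le_one₀ hS (norm_nonneg _) hS)
  nlinarith [norm_nonneg θ]

end EllTwo

/-- An injective operator with dense range of codimension at most one is surjective. -/
theorem ContinuousLinearMap.surjective_of_dense_of_codim_one {E : Type*} [NormedAddCommGroup E]
    [NormedSpace ℂ E] [CompleteSpace E] {A : E →L[ℂ] E} (hinj : Function.Injective A)
    (hdense : DenseRange A) (e : E) (he : ∀ h, ∃ x, ∃ c : ℂ, h = A x + c • e) :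
    Function.Surjective A := by
  by_cases hmem : e ∈ A.range
  · obtain ⟨x₀, hx₀⟩ := hmem
    intro h
    obtain ⟨x, c, rfl⟩ := he h
    exact ⟨x + c • x₀, by rw [map_add, map_smul]; congr 2⟩
  · have he0 : e ≠ 0 := fun h => hmem (h ▸ Submodule.zero_mem _)
    -- The range has the line through e as a complement, so it is closed; being dense, it is
    -- everything.
    have hc : IsCompl A.range (Submodule.span ℂ {e}) := by
      refine ⟨(Submodule.disjoint_span_singleton' he0).2 hmem, codisjoint_iff.2 ?_⟩
      refine eq_top_iff.2 fun h _ => ?_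
      obtain ⟨x, c, rfl⟩ := he h
      exact Submodule.add_mem_sup ⟨x, rfl⟩
        (Submodule.smul_mem _ _ (Submodule.mem_span_singleton_self e))
    have hcl := A.closed_complemented_range_of_isCompl_of_ker_eq_bot _ hc
      (Submodule.closed_of_finiteDimensional _) (LinearMap.ker_eq_bot.2 hinj)
    intro h
    have h2 := hdense h
    rw [show Set.range A = (A.range : Set E) from rfl, hcl.closure_eq] at h2
    exact h2

/-- A sequence tending to zero whose characteristic roots have modulus one vanishes. -/
theorem eq_zero_of_recurrence_of_tendsto {v : ℕ → ℂ} {θ : ℂ} (hθ : ‖θ‖ = 1)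
    (hv : ∀ m, θ * v (m + 2) + θ * v m = (θ ^ 2 + 1) * v (m + 1))
    (h0 : Filter.Tendsto v Filter.atTop (𝓝 0)) (m : ℕ) : v m = 0 := by
  have const : ∀ D : ℕ → ℂ, (∀ m, ‖D (m + 1)‖ = ‖D m‖) → Filter.Tendsto D Filter.atTop (𝓝 0) →
      ∀ m, D m = 0 := by
    intro D hD hD0 m
    have hc : ∀ k, ‖D k‖ = ‖D 0‖ := fun k => by
      induction k with
      | zero => rfl
      | succ k ih => rw [hD, ih]
    have h1 := hD0.norm
    simp only [hc, norm_zero] at h1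
    have h2 := tendsto_nhds_unique tendsto_const_nhds h1
    exact norm_eq_zero.1 ((hc m).trans h2)
  -- The second-order recurrence factors into two first-order ones with roots θ⁻¹ and θ. Both
  -- preserve moduli, so convergence to zero kills first D and then v.
  have hD := const (fun m => v (m + 1) - θ * v m) (fun m => by
      have : v (m + 1) - θ * v m = θ * (v (m + 1 + 1) - θ * v (m + 1)) := by
        linear_combination -hv m
      rw [this, norm_mul, hθ, one_mul]) (by
      have := ((Filter.tendsto_add_atTop_iff_nat 1).2 h0).sub (h0.const_mul θ)
      simpa using this)
  refine const v (fun m => ?_) h0 m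
  rw [sub_eq_zero.1 (hD m), norm_mul, hθ, one_mul]

namespace TwoPeriodicJacobi

variable (J₀ : TwoPeriodicJacobi)

theorem coeff_parity (k : ℕ) :
    (J₀.a (k + 1) = J₀.a 1 ∧ J₀.a (k + 2) = J₀.a 0 ∧ J₀.b (k + 1) = J₀.b 1 ∧
      J₀.b (k + 2) = J₀.b 0) ∨
    (J₀.a (k + 1) = J₀.a 0 ∧ J₀.a (k + 2) = J₀.a 1 ∧ J₀.b (k + 1) = J₀.b 0 ∧
      J₀.b (k + 2) = J₀.b 1) := by
  rcases Nat.even_or_odd' k with ⟨m, rfl | rfl⟩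
  · left
    have ha := periodic_pair J₀.a_periodic m
    have hb := periodic_pair J₀.b_periodic m
    exact ⟨ha.2, (J₀.a_periodic _).trans ha.1, hb.2, (J₀.b_periodic _).trans hb.1⟩
  · right
    have ha := periodic_pair J₀.a_periodic m
    have hb := periodic_pair J₀.b_periodic m
    exact ⟨(J₀.a_periodic _).trans ha.1, (J₀.a_periodic _).trans ha.2,
      (J₀.b_periodic _).trans hb.1, (J₀.b_periodic _).trans hb.2⟩

/-- The operator minus a multiple of the identity. -/
noncomputable def shifted (z : ℂ) : EllTwo →L[ℂ] EllTwo :=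
  J₀.toJacobi.op - z • ContinuousLinearMap.id ℂ EllTwo

theorem shifted_apply (z : ℂ) (y : EllTwo) (k : ℕ) :
    J₀.shifted z y k = J₀.toJacobi.act y k - z * y k := rfl

theorem shifted_zero (z : ℂ) (y : EllTwo) :
    J₀.shifted z y 0 = (J₀.b 1 - z) * y 0 + J₀.a 1 * y 1 := by
  rw [shifted_apply]
  simp only [JacobiMatrix.act, toJacobi]
  ring

theorem shifted_succ (z : ℂ) (y : EllTwo) (k : ℕ) :
    J₀.shifted z y (k + 1) =
      J₀.a (k + 1) * y k + (J₀.b (k + 2) - z) * y (k + 1) + J₀.a (k + 2) * y (k + 2) := by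
  rw [shifted_apply]
  simp only [JacobiMatrix.act, toJacobi]
  ring

/-- The quadratic polynomial of the operator is a Toeplitz operator up to rank one. -/
theorem shifted_comp_shifted (z : ℂ) (y : EllTwo) :
    J₀.shifted z (J₀.shifted (J₀.b 0 + J₀.b 1 - z) y) =
      (-(J₀.a 0 * J₀.a 1 / J₀.multiplier z)) •
        ((1 - J₀.multiplier z • (EllTwo.shiftLeft * EllTwo.shiftLeft)) *
          (1 - J₀.multiplier z • (EllTwo.shiftRight * EllTwo.shiftRight))) y +
      (-(J₀.a 0 ^ 2 * y 0)) • lp.single 2 0 (1 : ℂ) := by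
  have h0 := J₀.multiplier_ne_zero z
  have hf := J₀.multiplier_factor z
  set θ := J₀.multiplier z
  set κ : ℂ := J₀.a 0 * J₀.a 1 / θ with hκ
  have hκ1 : κ * θ = J₀.a 0 * J₀.a 1 := by rw [hκ]; field_simp
  have hκ2 : κ + J₀.a 0 * J₀.a 1 * θ =
      (z - J₀.b 0) * (z - J₀.b 1) - J₀.a 0 ^ 2 - J₀.a 1 ^ 2 := by
    apply mul_left_cancel₀ h0
    linear_combination hκ1 - hf
  have ha2 : J₀.a 2 = J₀.a 0 := J₀.a_periodic 0
  have hb2 : J₀.b 2 = J₀.b 0 := J₀.b_periodic 0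
  have ha3 : J₀.a 3 = J₀.a 1 := J₀.a_periodic 1
  have hb3 : J₀.b 3 = J₀.b 1 := J₀.b_periodic 1
  -- With the backward shift on the left, `shiftLeft * shiftRight = 1` leaves no corner term, so the
  -- product is exactly Toeplitz. The rank-one term accounts for the absent a₀² in the top left
  -- entry of the squared matrix.
  have hR : ∀ k, (((1 - θ • (EllTwo.shiftLeft * EllTwo.shiftLeft)) *
      (1 - θ • (EllTwo.shiftRight * EllTwo.shiftRight))) y) k =
      (1 + θ ^ 2) * y k - θ * EllTwo.shiftRight (EllTwo.shiftRight y) k - θ * y (k + 2) := by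
    intro k
    change (y k - θ * EllTwo.shiftRight (EllTwo.shiftRight y) k) -
      θ * (y (k + 2) - θ * y k) = _
    ring
  ext k
  change _ = (-κ) * (((1 - θ • (EllTwo.shiftLeft * EllTwo.shiftLeft)) *
      (1 - θ • (EllTwo.shiftRight * EllTwo.shiftRight))) y) k +
      (-(J₀.a 0 ^ 2 * y 0)) * (lp.single 2 0 (1 : ℂ) : EllTwo) k
  rw [hR]
  rcases k with _ | _ | k
  · rw [shifted_zero, shifted_zero, shifted_succ, EllTwo.shiftRight_zero, lp.single_apply_self]
    simp only [zero_add, ha2, hb2]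
    linear_combination (-y 2 + θ * y 0) * hκ1 + y 0 * hκ2
  · rw [zero_add, shifted_succ, shifted_zero, shifted_succ, shifted_succ,
      EllTwo.shiftRight_succ, EllTwo.shiftRight_zero, lp.single_apply_ne _ _ _ one_ne_zero]
    simp only [zero_add, Nat.reduceAdd, ha2, hb2, ha3, hb3]
    linear_combination (-y 3 + θ * y 1) * hκ1 + y 1 * hκ2
  · rw [shifted_succ, shifted_succ, shifted_succ, shifted_succ,
      EllTwo.shiftRight_succ, EllTwo.shiftRight_succ, lp.single_apply_ne _ _ _ (by omega)]
    have e3 : J₀.a (k + 3) = J₀.a (k + 1) := J₀.a_periodic (k + 1)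
    have e4 : J₀.a (k + 4) = J₀.a (k + 2) := J₀.a_periodic (k + 2)
    have e5 : J₀.b (k + 3) = J₀.b (k + 1) := J₀.b_periodic (k + 1)
    have e6 : J₀.b (k + 4) = J₀.b (k + 2) := J₀.b_periodic (k + 2)
    simp only [add_assoc, Nat.reduceAdd, e3, e4, e5, e6]
    rcases J₀.coeff_parity k with ⟨h1, h2, h3, h4⟩ | ⟨h1, h2, h3, h4⟩
    · rw [h1, h2, h3, h4]
      linear_combination (-y (k + 4) - y k + θ * y (k + 2)) * hκ1 + y (k + 2) * hκ2
    · rw [h1, h2, h3, h4]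
      linear_combination (-y (k + 4) - y k + θ * y (k + 2)) * hκ1 + y (k + 2) * hκ2

/-- For |θ| < 1 both Toeplitz factors are invertible, so the range of J₀ − z has codimension at most
one. Injectivity and dense range then imply surjectivity. -/
theorem norm_multiplier_eq_one_of_mem {z : ℂ} (hz : z ∈ contSpectrum J₀.toJacobi.op) :
    ‖J₀.multiplier z‖ = 1 := by
  obtain ⟨hinj, hdense, hsurj⟩ := hz
  by_contra hne
  have hθ : ‖J₀.multiplier z‖ < 1 := lt_of_le_of_ne (J₀.norm_multiplier_le_one z) hne
  have h0 := J₀.multiplier_ne_zero z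
  have hκ : -(J₀.a 0 * J₀.a 1 / J₀.multiplier z : ℂ) ≠ 0 := by
    have h1 : (J₀.a 0 : ℂ) ≠ 0 := by exact_mod_cast (J₀.a_pos 0).ne'
    have h2 : (J₀.a 1 : ℂ) ≠ 0 := by exact_mod_cast (J₀.a_pos 1).ne'
    exact neg_ne_zero.2 (div_ne_zero (mul_ne_zero h1 h2) h0)
  have hU := (EllTwo.isUnit_one_sub_smul_sq EllTwo.norm_shiftLeft_le hθ).mul
    (EllTwo.isUnit_one_sub_smul_sq EllTwo.norm_shiftRight_le hθ)
  have hUs := (ContinuousLinearMap.isUnit_iff_bijective.1 hU).2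
  refine hsurj (ContinuousLinearMap.surjective_of_dense_of_codim_one hinj hdense
    (lp.single 2 0 (1 : ℂ)) fun h => ?_)
  obtain ⟨y, hy⟩ := hUs ((-(J₀.a 0 * J₀.a 1 / J₀.multiplier z : ℂ))⁻¹ • h)
  have key := J₀.shifted_comp_shifted z y
  rw [hy, smul_inv_smul₀ hκ] at key
  refine ⟨J₀.shifted (J₀.b 0 + J₀.b 1 - z) y, J₀.a 0 ^ 2 * y 0, ?_⟩
  change h = J₀.shifted z (J₀.shifted (J₀.b 0 + J₀.b 1 - z) y) + _
  rw [key, neg_smul, neg_add_cancel_right]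

/-- The first row is left out so that the lemma yields both injectivity and the absence of the first
basis vector from the range. -/
theorem eq_zero_of_shifted_succ_eq_zero {z : ℂ} (hθ : ‖J₀.multiplier z‖ = 1) {y : EllTwo}
    (hy : ∀ k, J₀.shifted z y (k + 1) = 0) : y = 0 := by
  have hf := J₀.multiplier_factor z
  have hα : (J₀.a 0 : ℂ) ≠ 0 := by exact_mod_cast (J₀.a_pos 0).ne'
  have hβ : (J₀.a 1 : ℂ) ≠ 0 := by exact_mod_cast (J₀.a_pos 1).ne'
  set θ := J₀.multiplier z
  -- Three consecutive rows combine to eliminate the coordinates k + 1 and k + 3.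
  have hrec : ∀ k, θ * y (k + 4) + θ * y k = (θ ^ 2 + 1) * y (k + 2) := by
    intro k
    have h1 := hy k
    have h2 := hy (k + 1)
    have h3 := hy (k + 2)
    rw [shifted_succ] at h1 h2 h3
    have e3 : J₀.a (k + 3) = J₀.a (k + 1) := J₀.a_periodic (k + 1)
    have e4 : J₀.a (k + 4) = J₀.a (k + 2) := J₀.a_periodic (k + 2)
    have e5 : J₀.b (k + 3) = J₀.b (k + 1) := J₀.b_periodic (k + 1)
    have e6 : J₀.b (k + 4) = J₀.b (k + 2) := J₀.b_periodic (k + 2)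
    simp only [add_assoc, Nat.reduceAdd, e3, e4, e5, e6] at h1 h2 h3
    apply mul_left_cancel₀ (mul_ne_zero hα hβ)
    rcases J₀.coeff_parity k with ⟨p1, p2, p3, p4⟩ | ⟨p1, p2, p3, p4⟩
    · rw [p1, p2, p4] at h1
      rw [p1, p2, p3] at h2
      rw [p1, p2, p4] at h3
      linear_combination θ * (J₀.a 0 * h1 + J₀.a 1 * h3 + (z - J₀.b 0) * h2) + y (k + 2) * hf
    · rw [p1, p2, p4] at h1
      rw [p1, p2, p3] at h2
      rw [p1, p2, p4] at h3
      linear_combination θ * (J₀.a 1 * h1 + J₀.a 0 * h3 + (z - J₀.b 1) * h2) + y (k + 2) * hf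
  ext i
  refine eq_zero_of_recurrence_of_tendsto (v := fun m => y (i + 2 * m)) hθ
    (fun m => hrec (i + 2 * m)) ?_ 0
  refine (EllTwo.tendsto_coord_zero y).comp ?_
  exact Filter.tendsto_atTop_mono (fun m => show m ≤ i + 2 * m by omega) Filter.tendsto_id

theorem shifted_single_zero (z : ℂ) : J₀.shifted z (lp.single 2 0 (1 : ℂ)) =
    lp.single 2 0 (J₀.b 1 - z) + lp.single 2 1 (J₀.a 1 : ℂ) := by
  ext j
  rw [lp.coeFn_add, Pi.add_apply]
  rcases j with _ | _ | j
  · rw [shifted_zero]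
    simp [lp.single_apply]
  · rw [shifted_succ]
    simp [lp.single_apply]
  · rw [shifted_succ]
    simp [lp.single_apply]

theorem shifted_single_succ (z : ℂ) (k : ℕ) : J₀.shifted z (lp.single 2 (k + 1) (1 : ℂ)) =
    lp.single 2 k (J₀.a (k + 1) : ℂ) + lp.single 2 (k + 1) (J₀.b (k + 2) - z) +
      lp.single 2 (k + 2) (J₀.a (k + 2) : ℂ) := by
  ext j
  simp only [lp.coeFn_add, Pi.add_apply]
  rcases j with _ | j
  · rw [shifted_zero]
    rcases k with _ | k <;> simp [lp.single_apply]
  · rw [shifted_succ]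
    simp only [lp.single_apply, Pi.single_apply]
    by_cases h1 : j = k + 1
    · subst h1
      simp [show ¬k + 1 + 1 = k by omega]
    · by_cases h2 : j = k
      · subst h2; simp
      · by_cases h3 : j + 1 = k
        · subst h3
          simp [show ¬j = j + 1 + 1 by omega]
        · have : j + 2 ≠ k + 1 := by omega
          simp [h1, h2, h3, this]

theorem mem_contSpectrum_of_norm_multiplier {x : ℝ} (hθ : ‖J₀.multiplier x‖ = 1) :
    (x : ℂ) ∈ contSpectrum J₀.toJacobi.op := by
  have hinj : ∀ y, J₀.shifted x y = 0 → y = 0 := fun y hy =>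
    J₀.eq_zero_of_shifted_succ_eq_zero hθ fun k => by rw [hy]; rfl
  refine ⟨(injective_iff_map_eq_zero (J₀.shifted x)).2 hinj, ?_, fun hs => ?_⟩
  -- Dense range by symmetry: a vector orthogonal to the images of all basis vectors lies in the
  -- kernel, because x and the entries are real.
  · have h : (J₀.shifted x).rangeᗮ = ⊥ := by
      rw [Submodule.eq_bot_iff]
      intro v hv
      have hv' : ∀ k, inner ℂ (J₀.shifted x (lp.single 2 k (1 : ℂ))) v = 0 := fun k =>
        (Submodule.mem_orthogonal _ _).1 hv _ ⟨_, rfl⟩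
      apply hinj
      ext k
      rcases k with _ | k
      · have := hv' 0
        rw [shifted_single_zero, inner_add_left, lp.inner_single_left, lp.inner_single_left] at this
        rw [shifted_zero]
        simp at this
        simp
        linear_combination this
      · have := hv' (k + 1)
        rw [shifted_single_succ, inner_add_left, inner_add_left, lp.inner_single_left,
          lp.inner_single_left, lp.inner_single_left] at this
        rw [shifted_succ]
        simp at this
        simp
        linear_combination this
    have h2 := Submodule.topologicalClosure_eq_top_iff.2 h
    exact Submodule.dense_iff_topologicalClosure_eq_top.2 h2
  · obtain ⟨y, hy⟩ := hs (lp.single 2 0 (1 : ℂ))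
    change J₀.shifted x y = _ at hy
    have h0 := J₀.eq_zero_of_shifted_succ_eq_zero hθ (y := y) fun k => by
      rw [hy, lp.single_apply_ne _ _ _ (Nat.succ_ne_zero k)]
    rw [h0, map_zero] at hy
    have := congrArg (fun y : EllTwo => y 0) hy
    simp only [lp.single_apply_self] at this
    exact zero_ne_one this

end TwoPeriodicJacobi

/-! ### Consequences of compactness of J − J₀. -/

/-- The superdiagonal of a compact operator on `ℓ²` tends to zero. -/
theorem IsCompactOperator.tendsto_superdiagonal {K : EllTwo →L[ℂ] EllTwo}
    (hK : IsCompactOperator K) :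
    Filter.Tendsto (fun n => K (lp.single 2 (n + 1) (1 : ℂ)) n) Filter.atTop (𝓝 0) := by
  by_contra hnot
  rw [Metric.tendsto_atTop] at hnot
  push Not at hnot
  obtain ⟨ε, hε, hN⟩ := hnot
  obtain ⟨φ, hφ, hφε⟩ := Filter.extraction_of_frequently_atTop
    (Filter.frequently_atTop.2 hN)
  -- Along a subsequence the images of the basis vectors converge in norm to some g, and the
  -- coordinates of g tend to zero, so the selected entries cannot stay above ε.
  obtain ⟨S, hS, hKS⟩ := hK.image_closedBall_subset_compact 1
  obtain ⟨g, -, ψ, hψ, hlim⟩ := hS.tendsto_subseq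
    (x := fun n => K (lp.single 2 (φ n + 1) (1 : ℂ))) fun n => hKS ⟨_, by
      rw [mem_closedBall_zero_iff, lp.norm_single (by norm_num), norm_one], rfl⟩
  have h1 := (tendsto_iff_norm_sub_tendsto_zero.1 hlim).add
    ((EllTwo.tendsto_coord_zero g).comp (hφ.comp hψ).tendsto_atTop).norm
  rw [norm_zero, add_zero] at h1
  refine hε.not_ge (ge_of_tendsto' h1 fun n => (hφε (ψ n)).trans ?_)
  rw [dist_zero_right]
  have h2 := lp.norm_apply_le_norm (p := 2) (by norm_num)
    (K (lp.single 2 (φ (ψ n) + 1) (1 : ℂ)) - g) (φ (ψ n))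
  rw [lp.coeFn_sub, Pi.sub_apply] at h2
  have h3 := norm_sub_norm_le (K (lp.single 2 (φ (ψ n) + 1) (1 : ℂ)) (φ (ψ n))) (g (φ (ψ n)))
  simp only [Function.comp_apply]
  linarith

theorem JacobiMatrix.op_single_superdiagonal (J : JacobiMatrix) (n : ℕ) :
    J.op (lp.single 2 (n + 1) (1 : ℂ)) n = J.c (n + 1) := by
  rw [op_apply]
  rcases n with _ | n
  · simp [act, lp.single_apply]
  · simp [act, lp.single_apply, show ¬n = n + 1 + 1 by omega]

/-- Points of the continuous spectrum stay in the spectrum under compact perturbations. -/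
theorem mem_spectrum_of_mem_contSpectrum {T T₀ : EllTwo →L[ℂ] EllTwo}
    (hK : IsCompactOperator (T - T₀)) {z : ℂ} (hz : z ∈ contSpectrum T₀) : z ∈ spectrum ℂ T := by
  obtain ⟨hinj, -, hsurj⟩ := hz
  by_contra hT
  obtain ⟨U, hU⟩ := spectrum.notMem_iff.1 hT
  have halg : ∀ y : EllTwo, (algebraMap ℂ (EllTwo →L[ℂ] EllTwo) z) y = z • y := fun y => by
    rw [Algebra.algebraMap_eq_smul_one]; rfl
  -- If z − T is invertible, then z − T₀ = (z − T)(1 − C) with C compact. Injectivity of T₀ − z and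
  -- the Fredholm alternative make 1 − C invertible, contradicting non-surjectivity.
  set C : EllTwo →L[ℂ] EllTwo := -((↑U⁻¹ : EllTwo →L[ℂ] EllTwo) * (T - T₀)) with hC
  have hfac : algebraMap ℂ _ z - T₀ = (U : EllTwo →L[ℂ] EllTwo) * (1 - C) := by
    rw [hC, sub_neg_eq_add, mul_add, mul_one, ← mul_assoc, Units.mul_inv, one_mul, hU]
    abel
  have happly : ∀ y, (U : EllTwo →L[ℂ] EllTwo) ((1 - C) y) =
      -((T₀ - z • ContinuousLinearMap.id ℂ EllTwo) y) := fun y => by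
    change ((U : EllTwo →L[ℂ] EllTwo) * (1 - C)) y = _
    rw [← hfac]
    simp [halg]
  have hCc : IsCompactOperator C := by
    have := (hK.clm_comp (↑U⁻¹ : EllTwo →L[ℂ] EllTwo)).neg
    exact this
  have hne : ¬ Module.End.HasEigenvalue (C : EllTwo →ₗ[ℂ] EllTwo) 1 := by
    intro h
    obtain ⟨y, hy⟩ := h.exists_hasEigenvector
    have h1 : C y = (1 : ℂ) • y := hy.apply_eq_smul
    have h2 : (1 - C) y = 0 := by
      change y - C y = 0
      rw [h1, one_smul, sub_self]
    have h3 := happly y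
    rw [h2, map_zero] at h3
    exact hy.2 (hinj ((neg_eq_zero.1 h3.symm).trans (map_zero _).symm))
  have hres := (hCc.hasEigenvalue_or_mem_resolventSet one_ne_zero).resolve_left hne
  rw [spectrum.mem_resolventSet_iff, map_one] at hres
  have hbij := (ContinuousLinearMap.isUnit_iff_bijective.1 (U.isUnit.mul hres)).2
  refine hsurj fun h => ?_
  obtain ⟨y, hy⟩ := hbij (-h)
  refine ⟨y, neg_injective ?_⟩
  rw [← happly, ← hy]
  rfl

theorem exists_mem_Icc_ne_near {p q x r : ℝ} (hpq : p < q) (hx : x ∈ Set.Icc p q) (hr : 0 < r) :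
    ∃ x' ∈ Set.Icc p q, x' ≠ x ∧ |x' - x| < r := by
  rcases hx.2.lt_or_eq with h | rfl
  · refine ⟨min q (x + r / 2), ⟨le_min hpq.le (by linarith [hx.1]), min_le_left _ _⟩, ?_, ?_⟩
    · exact (lt_min h (by linarith)).ne'
    · have h1 : x < min q (x + r / 2) := lt_min h (by linarith)
      rw [abs_of_pos (by linarith)]
      linarith [min_le_right q (x + r / 2)]
  · refine ⟨max p (x - r / 2), ⟨le_max_left _ _, max_le hpq.le (by linarith)⟩, ?_, ?_⟩
    · exact (max_lt hpq (by linarith)).ne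
    · have h1 : max p (x - r / 2) < x := max_lt hpq (by linarith)
      rw [abs_of_neg (by linarith)]
      linarith [le_max_right p (x - r / 2)]

/-! ### Parameters read off from the bands, the exceptional value of the multiplier, and the
constant. -/

namespace TwoPeriodicJacobi

variable (J₀ : TwoPeriodicJacobi)

/-- The bands determine the mean of the diagonal and the two gap parameters. -/
theorem parameters_of_bands {s d : ℝ} (hs : 0 < s) (hsd : s < d)
    (hbands : contSpectrum J₀.toJacobi.op =
      (fun x : ℝ => (x : ℂ)) '' (Set.Icc (-d) (-s) ∪ Set.Icc s d)) :
    J₀.b 0 + J₀.b 1 = 0 ∧ d ^ 2 = J₀.b 1 ^ 2 + (J₀.a 1 + J₀.a 0) ^ 2 ∧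
      s ^ 2 = J₀.b 1 ^ 2 + (J₀.a 1 - J₀.a 0) ^ 2 := by
  have key : ∀ x : ℝ, x ∈ Set.Icc (-d) (-s) ∪ Set.Icc s d ↔
      (J₀.a 1 - J₀.a 0) ^ 2 ≤ (x - J₀.b 0) * (x - J₀.b 1) ∧
      (x - J₀.b 0) * (x - J₀.b 1) ≤ (J₀.a 1 + J₀.a 0) ^ 2 := by
    intro x
    rw [← norm_multiplier_eq_one_iff]
    constructor
    · intro hx
      exact J₀.norm_multiplier_eq_one_of_mem (hbands ▸ ⟨x, hx, rfl⟩)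
    · intro hx
      have := J₀.mem_contSpectrum_of_norm_multiplier hx
      rw [hbands] at this
      obtain ⟨x', hx', he⟩ := this
      rwa [← Complex.ofReal_injective he]
  have hα := J₀.a_pos 0
  have hβ := J₀.a_pos 1
  set c := (J₀.b 0 + J₀.b 1) / 2 with hc
  set δ := (J₀.b 0 - J₀.b 1) / 2 with hδ
  have hpoly : ∀ x, (x - J₀.b 0) * (x - J₀.b 1) = (x - c) ^ 2 - δ ^ 2 := fun x => by
    rw [hc, hδ]; ring
  simp only [hpoly] at key
  have habs : ∀ x ∈ Set.Icc (-d) (-s) ∪ Set.Icc s d, -d ≤ x ∧ x ≤ d := by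
    rintro x (hx | hx)
    · exact ⟨hx.1, by linarith [hx.2]⟩
    · exact ⟨by linarith [hx.1], hx.2⟩
  set D := √(δ ^ 2 + (J₀.a 1 + J₀.a 0) ^ 2) with hD
  have hD2 : D ^ 2 = δ ^ 2 + (J₀.a 1 + J₀.a 0) ^ 2 := Real.sq_sqrt (by positivity)
  have hD0 : 0 ≤ D := Real.sqrt_nonneg _
  set S := √(δ ^ 2 + (J₀.a 1 - J₀.a 0) ^ 2) with hS
  have hS2 : S ^ 2 = δ ^ 2 + (J₀.a 1 - J₀.a 0) ^ 2 := Real.sq_sqrt (by positivity)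
  have hS0 : 0 ≤ S := Real.sqrt_nonneg _
  have hαβ := mul_pos hα hβ
  -- The outermost points c ± D of the level set lie in [−d, d], and ±d lie in the level set.
  -- Comparing gives d = D + c = D − c.
  have h1 := habs _ ((key (c + D)).2 (by constructor <;> nlinarith))
  have h2 := habs _ ((key (c - D)).2 (by constructor <;> nlinarith))
  have h3 := ((key d).1 (Or.inr ⟨hsd.le, le_rfl⟩)).2
  have h4 := ((key (-d)).1 (Or.inl ⟨le_rfl, by linarith⟩)).2
  have h5 : d - c ≤ D := by nlinarith
  have h6 : d + c ≤ D := by nlinarith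
  have hc0 : c = 0 := by linarith [h1.2, h2.1]
  have hdD : d = D := by linarith [h1.2, h2.1]
  have hb : J₀.b 0 + J₀.b 1 = 0 := by linarith
  have hδb : δ ^ 2 = J₀.b 1 ^ 2 := by
    rw [hδ, show J₀.b 0 = -J₀.b 1 by linarith]; ring
  have h7 := ((key s).1 (Or.inr ⟨le_rfl, hsd.le⟩)).1
  rw [hc0] at h7 key
  have h8 : S ∈ Set.Icc (-d) (-s) ∪ Set.Icc s d := (key S).2 (by constructor <;> nlinarith)
  have h9 : s ≤ S := by
    rcases h8 with h | h
    · linarith [h.2]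
    · exact h.1
  have h10 : S ≤ s := by nlinarith
  refine ⟨hb, ?_, ?_⟩
  · rw [hdD, hD2, hδb]
  · rw [le_antisymm h9 h10, hS2, hδb]

theorem perturbation_self : perturbation J₀ J₀.toJacobi = 0 := by
  funext k
  have := J₀.ofReal_a_ne_zero k
  simp [perturbation, toJacobi, this]

/-- If `a₁ < a₂`, then `b₁` is an eigenvalue. -/
theorem hasEigenvalue_nu (h : J₀.a 1 < J₀.a 0) :
    Module.End.HasEigenvalue (J₀.toJacobi.op : EllTwo →ₗ[ℂ] EllTwo) (J₀.b 1 : ℂ) := by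
  have hα := J₀.a_pos 0
  have hβ := J₀.a_pos 1
  have hα' := J₀.ofReal_a_ne_zero 0
  set q : ℝ := J₀.a 1 / J₀.a 0 with hq
  have hq0 : 0 < q := div_pos hβ hα
  have hq1 : q < 1 := (div_lt_one hα).2 h
  -- At energy b₁ the odd rows (one-based) allow a vector supported on odd sites; the even rows give
  -- the ratio −a₁/a₂.
  let y : ℕ → ℂ := fun k => if Even k then (-(q : ℂ)) ^ (k / 2) else 0
  have hmem : Memℓp y 2 := by
    refine (memℓp_gen_iff (p := 2) (by norm_num)).2 ?_
    simp only [ENNReal.toReal_ofNat, Real.rpow_ofNat]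
    refine Summable.of_nonneg_of_le (fun k => by positivity) (fun k => ?_)
      (summable_geometric_of_lt_one hq0.le hq1)
    rcases Nat.even_or_odd' k with ⟨m, rfl | rfl⟩
    · simp only [y, even_two.mul_right, if_true]
      rw [norm_pow, norm_neg, Complex.norm_of_nonneg hq0.le, ← pow_mul,
        Nat.mul_div_cancel_left _ two_pos, mul_comm]
    · simp only [y, if_neg (Nat.not_even_two_mul_add_one m)]
      rw [norm_zero, zero_pow two_ne_zero]
      exact pow_nonneg hq0.le _
  have he : ∀ m, y (2 * m) = (-(q : ℂ)) ^ m := fun m => by simp [y]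
  have ho : ∀ m, y (2 * m + 1) = 0 := fun m => by simp [y]
  have hqc : J₀.a 0 * (q : ℂ) = J₀.a 1 := by
    rw [hq]; push_cast; field_simp
  have hs : J₀.shifted (J₀.b 1) ⟨y, hmem⟩ = 0 := by
    ext k
    change J₀.shifted (J₀.b 1) ⟨y, hmem⟩ k = 0
    rcases k with _ | k
    · rw [shifted_zero]
      change (J₀.b 1 - J₀.b 1 : ℂ) * y 0 + J₀.a 1 * y 1 = 0
      rw [ho 0, sub_self, zero_mul, mul_zero, add_zero]
    · rw [shifted_succ]
      change J₀.a (k + 1) * y k + (J₀.b (k + 2) - J₀.b 1) * y (k + 1) + J₀.a (k + 2) * y (k + 2) = 0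
      rcases Nat.even_or_odd' k with ⟨m, rfl | rfl⟩
      · rw [he, ho, show 2 * m + 2 = 2 * (m + 1) by ring, he,
          (periodic_pair J₀.a_periodic m).2, (periodic_pair J₀.a_periodic (m + 1)).1]
        linear_combination -(-(q : ℂ)) ^ m * hqc
      · rw [ho, show 2 * m + 1 + 2 = 2 * (m + 1) + 1 by ring, ho,
          (periodic_pair J₀.b_periodic (m + 1)).2]
        ring
  apply Module.End.hasEigenvalue_of_hasEigenvector (x := (⟨y, hmem⟩ : EllTwo))
  refine ⟨Module.End.mem_eigenspace_iff.2 (sub_eq_zero.1 hs), fun h0 => ?_⟩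
  have h1 : y 0 = 0 := congrArg (fun v : EllTwo => v 0) h0
  rw [he 0, pow_zero] at h1
  exact one_ne_zero h1

/-- The Green criterion with zero perturbation: for a₂ ≤ a₁ and |θ| < 1 the denominator a₁ + a₂θ
cannot vanish. -/
theorem not_hasEigenvalue_gap (h : J₀.a 0 ≤ J₀.a 1) {s d : ℝ} (hd0 : 0 ≤ d)
    (hb : J₀.b 0 + J₀.b 1 = 0) (hd : d ^ 2 = J₀.b 1 ^ 2 + (J₀.a 1 + J₀.a 0) ^ 2)
    (hs : s ^ 2 = J₀.b 1 ^ 2 + (J₀.a 1 - J₀.a 0) ^ 2) {μ : ℝ} (h1 : -s < μ) (h2 : μ < s) :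
    ¬ Module.End.HasEigenvalue (J₀.toJacobi.op : EllTwo →ₗ[ℂ] EllTwo) (μ : ℂ) := by
  have hα := J₀.a_pos 0
  have hθ : ‖J₀.multiplier μ‖ < 1 := by
    refine lt_of_le_of_ne (J₀.norm_multiplier_le_one _) fun h => ?_
    have := ((J₀.norm_multiplier_eq_one_iff μ).1 h).1
    rw [show J₀.b 0 = -J₀.b 1 by linarith] at this
    nlinarith
  refine J₀.not_hasEigenvalue_of_green J₀.toJacobi ?_ ?_ hd0 hb hd hθ ?_ ?_
  · simp [toJacobi]
  · rw [perturbation_self]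
    exact summable_zero
  · intro h0
    have h3 : (J₀.a 1 : ℂ) = -(J₀.a 0 * J₀.multiplier μ) := by linear_combination h0
    have h4 := congrArg norm h3
    rw [norm_neg, norm_mul, Complex.norm_of_nonneg (J₀.a_pos 1).le,
      Complex.norm_of_nonneg hα.le] at h4
    nlinarith
  · rw [perturbation_self]
    simpa using hα

/-- The exceptional value of the multiplier. -/
theorem w_nu_zpow {s d : ℝ} (hs0 : 0 < s) (hd0 : 0 ≤ d)
    (hb : J₀.b 0 + J₀.b 1 = 0) (hd : d ^ 2 = J₀.b 1 ^ 2 + (J₀.a 1 + J₀.a 0) ^ 2)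
    (hs : s ^ 2 = J₀.b 1 ^ 2 + (J₀.a 1 - J₀.a 0) ^ 2) :
    J₀.w J₀.nu ^ (2 * J₀.eps s) = -(J₀.a 1 / J₀.a 0 : ℂ) := by
  have hα := J₀.a_pos 0
  have hβ := J₀.a_pos 1
  have hα' := J₀.ofReal_a_ne_zero 0
  have hβ' := J₀.ofReal_a_ne_zero 1
  have hle := J₀.norm_multiplier_le_one J₀.nu
  have hf := J₀.multiplier_factor J₀.nu
  rw [show ((J₀.nu : ℂ) - J₀.b 1) = 0 from sub_self _, mul_zero, zero_mul] at hf
  have hzpow : J₀.w J₀.nu ^ (2 * J₀.eps s) = J₀.multiplier J₀.nu ^ J₀.eps s := by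
    rw [zpow_mul, ← w_sq]
    norm_cast
  rw [hzpow]
  set θ := J₀.multiplier J₀.nu
  have hroot : J₀.a 0 = J₀.a 1 * ‖θ‖ ∧ θ = -(J₀.a 0 / J₀.a 1 : ℂ) ∨
      J₀.a 1 = J₀.a 0 * ‖θ‖ ∧ θ = -(J₀.a 1 / J₀.a 0 : ℂ) := by
    rcases mul_eq_zero.1 hf.symm with h | h
    · left
      have h1 : θ = -(J₀.a 0 / J₀.a 1 : ℂ) := by field_simp; linear_combination h
      refine ⟨?_, h1⟩
      rw [h1, norm_neg, norm_div, Complex.norm_of_nonneg hα.le, Complex.norm_of_nonneg hβ.le]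
      field_simp
    · right
      have h1 : θ = -(J₀.a 1 / J₀.a 0 : ℂ) := by field_simp; linear_combination h
      refine ⟨?_, h1⟩
      rw [h1, norm_neg, norm_div, Complex.norm_of_nonneg hα.le, Complex.norm_of_nonneg hβ.le]
      field_simp
  rcases lt_or_ge (J₀.a 1) (J₀.a 0) with h | h
  · have heps : J₀.eps s = 1 := by
      have hlt : |J₀.b 1| < s := by
        apply abs_lt_of_sq_lt_sq _ hs0.le
        nlinarith [mul_pos (sub_pos.2 h) (sub_pos.2 h)]
      exact if_pos ⟨J₀.b 1, (abs_lt.1 hlt).1, (abs_lt.1 hlt).2, J₀.hasEigenvalue_nu h⟩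
    rw [heps, zpow_one]
    rcases hroot with ⟨h1, -⟩ | ⟨-, h1⟩
    · nlinarith
    · exact h1
  · have heps : J₀.eps s = -1 := if_neg fun ⟨μ, h1, h2, h3⟩ =>
      J₀.not_hasEigenvalue_gap h hd0 hb hd hs h1 h2 h3
    rw [heps, zpow_neg_one]
    rcases hroot with ⟨-, h1⟩ | ⟨h0, h1⟩
    · rw [h1, inv_neg, inv_div]
    · have h2 : J₀.a 0 = J₀.a 1 := by nlinarith
      rw [h1, inv_neg, inv_div, h2]

/-- Compares `kTwo` with what the contraction needs, with α = a₂⁰ and β = a₁⁰. The bounds d(d − s) ≤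
d² − s² = 4αβ and β ≤ d give d(d − s)² ≤ 16βα²; the other factors are estimated by powers of d, with
room to spare. -/
theorem kTwo_lower_bound {s d α β : ℝ} (hs : 0 < s) (hsd : s < d) (hα : 0 < α) (hβ : 0 < β)
    (hβd : β ≤ d) (hαβ : 4 * (α * β) = d ^ 2 - s ^ 2) :
    4 * d ^ 2 ≤ kTwo s d * (β * α ^ 2) := by
  have hd : 0 < d := hs.trans hsd
  have hds : 0 < d - s := sub_pos.2 hsd
  have hpos : 0 < d ^ 2 - s ^ 2 := by nlinarith
  have hsq : 0 < √(d ^ 2 - s ^ 2) := Real.sqrt_pos.2 hpos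
  have hsqd : √(d ^ 2 - s ^ 2) ≤ d := by
    rw [Real.sqrt_le_left hd.le]
    nlinarith
  have hsq2 : (1 : ℝ) ≤ √2 := Real.one_le_sqrt.2 (by norm_num)
  have h1 : (d - s) ^ 2 * d ^ 2 ≤ (4 * (α * β)) ^ 2 := by
    rw [hαβ, ← mul_pow]
    apply pow_le_pow_left₀ (by positivity)
    nlinarith
  have h2 : (d - s) ^ 2 * d ≤ 16 * (β * α ^ 2) := by
    have : (4 * (α * β)) ^ 2 ≤ 16 * (β * α ^ 2) * d := by
      nlinarith [mul_le_mul_of_nonneg_left hβd (by positivity : 0 ≤ 16 * (β * α ^ 2))]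
    nlinarith
  rw [kTwo, div_mul_eq_mul_div, le_div_iff₀ (by positivity)]
  calc 4 * d ^ 2 * ((d - s) ^ 5 * √(d ^ 2 - s ^ 2))
      = 4 * d ^ 2 * ((d - s) ^ 3 * √(d ^ 2 - s ^ 2)) * (d - s) ^ 2 := by ring
    _ ≤ 4 * d ^ 2 * (d ^ 3 * d) * (d - s) ^ 2 := by
      gcongr
      linarith
    _ = 4 * d ^ 5 * ((d - s) ^ 2 * d) := by ring
    _ ≤ 4 * d ^ 5 * (16 * (β * α ^ 2)) := by gcongr
    _ = 64 * 1 * d ^ 5 * (β * α ^ 2) := by ring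
    _ ≤ 1024 * √2 * d ^ 5 * (β * α ^ 2) := by gcongr; norm_num

end TwoPeriodicJacobi

/-! ### Conclusion. -/

theorem theorem1p1 (J₀ : TwoPeriodicJacobi) (J : JacobiMatrix) (s d t : ℝ)
    (hs : 0 < s) (hsd : s < d)
    (hbands : contSpectrum J₀.toJacobi.op =
      (fun x : ℝ => (x : ℂ)) '' (Set.Icc (-d) (-s) ∪ Set.Icc s d))
    (hcompact : IsCompactOperator (J.op - J₀.toJacobi.op))
    (hsum : Summable (perturbation J₀ J))
    (ht : 0 < t) (htexp : t * Real.exp t = 1) :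
    ∀ z ∈ freeRegion J₀ J s d t,
      z ∉ discSpectrum J.op ∧
      (z ∉ contSpectrum J₀.toJacobi.op →
        ¬ Module.End.HasEigenvalue (J.op : EllTwo →ₗ[ℂ] EllTwo) z) := by
  intro z hz
  have hd0 : 0 < d := hs.trans hsd
  obtain ⟨hb, hd, hs2⟩ := J₀.parameters_of_bands hs hsd hbands
  have hoff : z ∉ contSpectrum J₀.toJacobi.op →
      ¬ Module.End.HasEigenvalue (J.op : EllTwo →ₗ[ℂ] EllTwo) z := by
    intro hzc
    have hα := J₀.a_pos 0
    have hβ := J₀.a_pos 1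
    have hα' := J₀.ofReal_a_ne_zero 0
    have hθ : ‖J₀.multiplier z‖ < 1 := by
      refine lt_of_le_of_ne (J₀.norm_multiplier_le_one z) fun h => hzc ?_
      have him := J₀.im_eq_zero_of_norm_multiplier z h
      have hre : z = (z.re : ℂ) := Complex.ext rfl (by simpa using him)
      rw [hre] at h ⊢
      exact J₀.mem_contSpectrum_of_norm_multiplier h
    -- Since eᵗ > 1 + t, the equation teᵗ = 1 forces t < 1, the contraction threshold.
    have ht1 : t < 1 := by nlinarith [Real.add_one_lt_exp ht.ne']
    obtain ⟨hden, hlt⟩ := hz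
    have e1 : ‖J₀.w z ^ 2 - J₀.w J₀.nu ^ (2 * J₀.eps s)‖ =
        ‖(J₀.a 1 + J₀.a 0 * J₀.multiplier z : ℂ)‖ / J₀.a 0 := by
      rw [J₀.w_nu_zpow hs hd0.le hb hd hs2, J₀.w_sq,
        show J₀.multiplier z - -(J₀.a 1 / J₀.a 0 : ℂ) =
          (J₀.a 1 + J₀.a 0 * J₀.multiplier z) / J₀.a 0 by field_simp; ring,
        norm_div, Complex.norm_of_nonneg hα.le]
    have e2 : J₀.w z ^ 4 = J₀.multiplier z ^ 2 := by rw [← J₀.w_sq]; ring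
    rw [e1, e2] at hden hlt
    obtain ⟨hD, hE⟩ := mul_ne_zero_iff.1 hden
    have hD' : ‖(J₀.a 1 + J₀.a 0 * J₀.multiplier z : ℂ)‖ ≠ 0 := (div_ne_zero_iff.1 hD).1
    have hca : Filter.Tendsto (fun n => J.c (n + 1) - J₀.a (n + 1)) Filter.atTop (𝓝 0) := by
      refine hcompact.tendsto_superdiagonal.congr fun n => ?_
      change J.op (lp.single 2 (n + 1) (1 : ℂ)) n -
        J₀.toJacobi.op (lp.single 2 (n + 1) (1 : ℂ)) n = _
      rw [J.op_single_superdiagonal, J₀.toJacobi.op_single_superdiagonal]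
      rfl
    refine J₀.not_hasEigenvalue_of_green J hca hsum hd0.le hb hd hθ (norm_ne_zero_iff.1 hD') ?_
    have hβd : J₀.a 1 ≤ d := by nlinarith [sq_nonneg (J₀.b 1)]
    have hK := TwoPeriodicJacobi.kTwo_lower_bound hs hsd hα hβ hβd (by rw [hd, hs2]; ring)
    have hDpos := (norm_nonneg _).lt_of_ne' hD'
    have hEpos := (norm_nonneg _).lt_of_ne' hE
    have hsum0 : 0 ≤ ∑' k, perturbation J₀ J k :=
      tsum_nonneg fun k => add_nonneg (norm_nonneg _) (norm_nonneg _)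
    set D := ‖(J₀.a 1 + J₀.a 0 * J₀.multiplier z : ℂ)‖
    set E := ‖1 - J₀.multiplier z ^ 2‖
    calc _ ≤ kTwo s d * (J₀.a 1 * J₀.a 0 ^ 2) * ‖J₀.w z‖ / (J₀.a 1 * D * E) *
          ∑' k, perturbation J₀ J k := by gcongr
      _ = J₀.a 0 * (kTwo s d * ‖J₀.w z‖ / (D / J₀.a 0 * E) * ∑' k, perturbation J₀ J k) := by
        field_simp
      _ < J₀.a 0 * 1 := by
        gcongr
        exact hlt.trans ht1
      _ = _ := mul_one _
  refine ⟨fun hdisc => ?_, hoff⟩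
  obtain ⟨⟨r, hr, hiso⟩, hev, -⟩ := hdisc
  -- Inside a band, other band points arbitrarily near z also lie in the spectrum of J, so z is not
  -- isolated.
  by_cases hzc : z ∈ contSpectrum J₀.toJacobi.op
  · have hzc' := hzc
    rw [hbands] at hzc'
    obtain ⟨x, hx, rfl⟩ := hzc'
    obtain ⟨x', hx', hne, hnear⟩ : ∃ x' ∈ Set.Icc (-d) (-s) ∪ Set.Icc s d,
        x' ≠ x ∧ |x' - x| < r := by
      rcases hx with hx | hx
      · obtain ⟨x', h1, h2⟩ := exists_mem_Icc_ne_near (by linarith) hx hr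
        exact ⟨x', Or.inl h1, h2⟩
      · obtain ⟨x', h1, h2⟩ := exists_mem_Icc_ne_near hsd hx hr
        exact ⟨x', Or.inr h1, h2⟩
    have hspec := mem_spectrum_of_mem_contSpectrum hcompact (z := (x' : ℂ))
      (hbands ▸ ⟨x', hx', rfl⟩)
    have hmem : (x' : ℂ) ∈ spectrum ℂ J.op ∩ Metric.ball (x : ℂ) r := by
      refine ⟨hspec, ?_⟩
      rw [Metric.mem_ball, Complex.dist_eq, ← Complex.ofReal_sub, Complex.norm_real]
      exact hnear
    rw [hiso] at hmem
    exact hne (Complex.ofReal_injective hmem)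
  · exact hoff hzc hev
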